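/- Let $\mathcal E$ be a finitely complete and finitely cocomplete (for instance, a finitely complete and cocomplete) symmetric monoidal closed category with tensor unit $U$ and symmetry $\tau$. **Intervals.** An *interval* in $\mathcal E$ is a cocategory whose object of coobjects is $U$: an object $I$ with maps $\bot,\top:U\to I$, $i:I\to U$, a pushout $I_2$ of $\top$ and $\bot$ with injections $\downarrow,\uparrow:I\to I_2$ ($\downarrow\top=\uparrow\bot$), and a map $\star:I\to I_2$, satisfying the duals of the category axioms: $i\bot=1=i\top$, $\star\bot=\downarrow\bot$, $\star\top=\uparrow\top$, the counit laws and coassociativity. For $h,k$ with $h\top=k\bot$, $[h,k]$ denotes the map on $I_2$ that is $h$ on $\downarrow$ and $k$ on $\uparrow$. The interval is *invertible* if there is $\sigma:I\to I$ with $\sigma\bot=\top$, $\sigma\top=\bot$, $[\sigma,1]\star=\top i$ and $[1,\sigma]\star=\bot i$. Morphisms of intervals are maps $I\to I'$ compatible with $\bot,\top,i,\star$. Every interval carries the comultiplication $\Delta=[(\bot\otimes I)\lambda^{-1},(I\otimes\top)\rho^{-1}]\star:I\to I\otimes I$. **Homotopies and representability.** A homotopy $f\Rightarrow g:A\to B$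 is a map $\eta:A\otimes I\to B$ with $\eta(A\otimes\bot)=f\rho$ and $\eta(A\otimes\top)=g\rho$. Arrows $A\to B$ and homotopies form a category, with vertical composition given by $\star$ and identities by $i$, and homotopies can be whiskered with arrows on either side. $I$ is *representable* if the homotopies are the 2-cells of a 2-category (that is, the interchange law holds) and this 2-category has cotensors with $\mathbf 2$. For representable $I$, the classes of maps of the *isofibration model structure* are: weak equivalences are the equivalences of the 2-category, fibrations are the maps $p$ for which every $p_*:\mathcal E(E,A)\to\mathcal E(E,B)$ is an isofibration of categories, and cofibrations are the maps with the left lifting property against the maps that are both fibrations and weak equivalences. **Hopf intervals.** A *commutative Hopf object* is an object with a commutative monoid and a comonoid structure such that multiplication and unit are comonoid homomorphisms. $U$ carries the trivial structure, and $U+U$ (with injections $\bot,\top$) carries the meet structure: multiplication $x\wedge\bot=\bot$, $x\wedge\top=x$; unit $\top$; comultiplication $x\mapsto x\otimes x$; counit the codiagonal. A *commutative Hopf interval* is a commutative Hopf object $H$ with Hopf morphisms $U+U\xrightarrow{[a,b]}H\xrightarrow{g}U$ composing to the codiagonal, the first a cofibration and the second a weak equivalence of the isofibration model structure. **The object $J$.**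 Given an interval $I$, let $K$ be the pushout of $[\bot,\top]:U+U\to I$ along $[\top,\bot]:U+U\to I$, with $\bot_K,\top_K,i_K$ extending those of the first copy of $I$, with $\star_K$ given by $\star$ on the first copy and by its reverse on the second, and with $\sigma_K:K\to K$ interchanging the copies. Let $q:K\to J$ be the quotient of $K$ by the relations $[\sigma_K,K]\star_K=\top_K i_K$ and $[K,\sigma_K]\star_K=\bot_K i_K$, and let $\iota:I\to J$ be the first copy of $I$ in $K$ followed by $q$. **Proposition.** Let $I$ be a representable interval in $\mathcal E$. Then: 1. The structure of $K$ induces along $q$ the structure of an invertible interval on $J$, with symmetry map induced by $\sigma_K$; $\iota$ is a morphism of intervals; and for every invertible interval $H$ and every morphism of intervals $\xi:I\to H$ there is a unique morphism of intervals $\bar\xi:J\to H$ with $\bar\xi\iota=\xi$. 2. For $L=I$ and for $L=J$ there is exactly one commutative Hopf object structure on $L$ with comultiplication $\Delta_L$, counit $i_L$, unit $\top_L$, and as multiplication a meet operation $\wedge_L:L\otimes L\to L$, i.e. a map such that $\wedge_L$ and $\wedge_L\circ\tau$ are both homotopies with respect to $L$ from $\bot_L\circ i_L$ to $1_L$. 3.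 $(J,\Delta_J,i_J,\wedge_J,\top_J)$ with $U+U\xrightarrow{[\bot_J,\top_J]}J\xrightarrow{i_J}U$ is a commutative Hopf interval; in particular, $[\bot_J,\top_J]$ is a cofibration and $i_J$ is a weak equivalence in the isofibration model structure (defined from $I$). 4. It is the free commutative Hopf interval generated by $I$: $\iota$ is a morphism of Hopf objects, and for every commutative Hopf interval $U+U\xrightarrow{[a,b]}H\xrightarrow{g}U$ and every morphism of Hopf objects $\xi:I\to H$ there is a unique morphism of Hopf objects $\bar\xi:J\to H$ with $\bar\xi\iota=\xi$. Moreover, $g\bar\xi=i_J$, and if $\xi\circ[\bot,\top]=[a,b]$ then $\bar\xi\circ[\bot_J,\top_J]=[a,b]$. -/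

import Mathlib

open CategoryTheory MonoidalCategory Limits

universe v u

noncomputable section

namespace StrictInterval

/-! ### Cocategories -/

/-- The structure maps of a cocategory with object of coobjects `C₀` and object of coarrows `C₁`.
`bot`, `top`, `coid`, `down`, `up`, `star` are dual to domain, codomain, identities, the two
projections and composition. -/
structure PreCocategory {C : Type u} [Category.{v} C] (C₀ C₁ : C) where
  /-- the object of cocomposable coarrows -/
  C₂ : C
  bot : C₀ ⟶ C₁
  top : C₀ ⟶ C₁
  coid : C₁ ⟶ C₀
  down : C₁ ⟶ C₂
  up : C₁ ⟶ C₂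
  star : C₁ ⟶ C₂
  isPushout : IsPushout top bot down up
  bot_coid : bot ≫ coid = 𝟙 C₀
  top_coid : top ≫ coid = 𝟙 C₀
  bot_star : bot ≫ star = bot ≫ down
  top_star : top ≫ star = top ≫ up

namespace PreCocategory

variable {C : Type u} [Category.{v} C] {C₀ C₁ : C} (P : PreCocategory C₀ C₁)

/-- The map `[h, k] : C₂ ⟶ Z` that is `h` on the initial segment `down` and `k` on the final
segment `up`. -/
def glue {Z : C} (h k : C₁ ⟶ Z) (w : P.top ≫ h = P.bot ≫ k) : P.C₂ ⟶ Z :=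
  P.isPushout.desc h k w

@[simp]
theorem down_glue {Z : C} (h k : C₁ ⟶ Z) (w : P.top ≫ h = P.bot ≫ k) :
    P.down ≫ P.glue h k w = h :=
  P.isPushout.inl_desc h k w

@[simp]
theorem up_glue {Z : C} (h k : C₁ ⟶ Z) (w : P.top ≫ h = P.bot ≫ k) :
    P.up ≫ P.glue h k w = k :=
  P.isPushout.inr_desc h k w

end PreCocategory

/-- A cocategory with object of coobjects `C₀` and object of coarrows `C₁`. -/
structure Cocategory {C : Type u} [Category.{v} C] (C₀ C₁ : C) extends PreCocategory C₀ C₁ where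
  counit_left : star ≫ toPreCocategory.glue (coid ≫ bot) (𝟙 C₁)
      (by rw [← Category.assoc, top_coid, Category.id_comp, Category.comp_id]) = 𝟙 C₁
  counit_right : star ≫ toPreCocategory.glue (𝟙 C₁) (coid ≫ top)
      (by rw [← Category.assoc, bot_coid, Category.id_comp, Category.comp_id]) = 𝟙 C₁
  /-- Coassociativity, for an object `C₃` of cocomposable triples. -/
  coassoc : ∀ {C₃ : C} (d u : C₂ ⟶ C₃) (h : IsPushout up down d u),
    star ≫ toPreCocategory.glue (down ≫ d) (star ≫ u)
        (by rw [← Category.assoc bot, bot_star, ← Category.assoc, isPushout.w, Category.assoc,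
          h.w, Category.assoc]) =
      star ≫ toPreCocategory.glue (star ≫ d) (up ≫ u)
        (by rw [← Category.assoc top, top_star, Category.assoc, h.w, ← Category.assoc,
          isPushout.w, Category.assoc])

/-- A (strict) interval with object of coarrows `X`: a cocategory whose object of coobjects is the
tensor unit. -/
abbrev Interval {C : Type u} [Category.{v} C] [MonoidalCategory C] (X : C) :=
  Cocategory (𝟙_ C) X

/-- Morphisms of intervals (identity on the object of coobjects). -/
structure IsIntervalHom {C : Type u} [Category.{v} C] [MonoidalCategory C] {X Y : C}
    (I : Interval X) (J : Interval Y) (f : X ⟶ Y) : Prop where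
  bot : I.bot ≫ f = J.bot
  top : I.top ≫ f = J.top
  coid : f ≫ J.coid = I.coid
  star : f ≫ J.star = I.star ≫ I.glue (f ≫ J.down) (f ≫ J.up)
    (by rw [← Category.assoc, top, J.isPushout.w, ← bot, Category.assoc])

namespace Cocategory

variable {C : Type u} [Category.{v} C] {C₀ C₁ : C} (P : Cocategory C₀ C₁)

/-- `s` is a symmetry (coinverse) map for the cocategory `P`. -/
structure IsSymmetry (s : C₁ ⟶ C₁) : Prop where
  bot : P.bot ≫ s = P.top
  top : P.top ≫ s = P.bot
  left : P.star ≫ P.glue s (𝟙 C₁) (by rw [top, Category.comp_id]) = P.coid ≫ P.top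
  right : P.star ≫ P.glue (𝟙 C₁) s (by rw [bot, Category.comp_id]) = P.coid ≫ P.bot

/-- A cocategory is invertible (a cogroupoid) if it has a symmetry map. -/
def Invertible : Prop := ∃ s : C₁ ⟶ C₁, P.IsSymmetry s

section Monoidal

variable {C : Type u} [Category.{v} C] [MonoidalCategory C] {X : C} (I : Interval X)

/-- The comultiplication `[(⊥ ⊗ I) λ⁻¹, (I ⊗ ⊤) ρ⁻¹] ∘ ⋆` of an interval. -/
def comul : X ⟶ X ⊗ X :=
  I.star ≫ I.glue ((λ_ X).inv ≫ I.bot ▷ X) ((ρ_ X).inv ≫ X ◁ I.top) (by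
    rw [leftUnitor_inv_naturality_assoc, rightUnitor_inv_naturality_assoc, whisker_exchange,
      unitors_inv_equal])

/-! ### Homotopies -/

/-- A homotopy from `f` to `g`. These are the 2-cells of the 2-dimensional structure induced
by `I`. -/
@[ext]
structure TwoCell {A B : C} (f g : A ⟶ B) where
  hom : A ⊗ X ⟶ B
  bot_hom : A ◁ I.bot ≫ hom = (ρ_ A).hom ≫ f
  top_hom : A ◁ I.top ≫ hom = (ρ_ A).hom ≫ g

namespace TwoCell

variable {I}

/-- The identity 2-cell. -/
@[simps]
def id {A B : C} (f : A ⟶ B) : I.TwoCell f f where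
  hom := A ◁ I.coid ≫ (ρ_ A).hom ≫ f
  bot_hom := by rw [← whiskerLeft_comp_assoc, I.bot_coid]; simp
  top_hom := by rw [← whiskerLeft_comp_assoc, I.top_coid]; simp

/-- Precomposition of a 2-cell with an arrow. -/
@[simps]
def whiskerLeft {A B D : C} (f : A ⟶ B) {g h : B ⟶ D} (η : I.TwoCell g h) :
    I.TwoCell (f ≫ g) (f ≫ h) where
  hom := f ▷ X ≫ η.hom
  bot_hom := by rw [whisker_exchange_assoc, η.bot_hom]; simp
  top_hom := by rw [whisker_exchange_assoc, η.top_hom]; simp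

/-- Postcomposition of a 2-cell with an arrow. -/
@[simps]
def whiskerRight {A B D : C} {f g : A ⟶ B} (η : I.TwoCell f g) (h : B ⟶ D) :
    I.TwoCell (f ≫ h) (g ≫ h) where
  hom := η.hom ≫ h
  bot_hom := by rw [← Category.assoc, η.bot_hom, Category.assoc]
  top_hom := by rw [← Category.assoc, η.top_hom, Category.assoc]

end TwoCell

/-- Tensoring with `A` preserves the pushout square of an interval. -/
theorem isPushout_whiskerLeft [MonoidalClosed C] (A : C) :
    IsPushout (A ◁ I.top) (A ◁ I.bot) (A ◁ I.down) (A ◁ I.up) :=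
  have : (tensorLeft A).IsLeftAdjoint := (ihom.adjunction A).isLeftAdjoint
  I.isPushout.map (tensorLeft A)

namespace TwoCell

variable {I} [MonoidalClosed C]

/-- The map `[η, γ] : A ⊗ I₂ ⟶ B` induced by a composable pair of 2-cells. -/
def pair {A B : C} {f g h : A ⟶ B} (η : I.TwoCell f g) (γ : I.TwoCell g h) : A ⊗ I.C₂ ⟶ B :=
  (I.isPushout_whiskerLeft A).desc η.hom γ.hom (η.top_hom.trans γ.bot_hom.symm)

@[simp]
theorem down_pair {A B : C} {f g h : A ⟶ B} (η : I.TwoCell f g) (γ : I.TwoCell g h) :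
    A ◁ I.down ≫ η.pair γ = η.hom :=
  IsPushout.inl_desc _ _ _ _

@[simp]
theorem down_pair_assoc {A B Z : C} {f g h : A ⟶ B} (η : I.TwoCell f g) (γ : I.TwoCell g h)
    (t : B ⟶ Z) : A ◁ I.down ≫ η.pair γ ≫ t = η.hom ≫ t := by
  rw [← Category.assoc, down_pair]

@[simp]
theorem up_pair {A B : C} {f g h : A ⟶ B} (η : I.TwoCell f g) (γ : I.TwoCell g h) :
    A ◁ I.up ≫ η.pair γ = γ.hom :=
  IsPushout.inr_desc _ _ _ _

@[simp]
theorem up_pair_assoc {A B Z : C} {f g h : A ⟶ B} (η : I.TwoCell f g) (γ : I.TwoCell g h)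
    (t : B ⟶ Z) : A ◁ I.up ≫ η.pair γ ≫ t = γ.hom ≫ t := by
  rw [← Category.assoc, up_pair]

/-- Vertical composition of 2-cells: first `η`, then `γ`. -/
@[simps]
def comp {A B : C} {f g h : A ⟶ B} (η : I.TwoCell f g) (γ : I.TwoCell g h) : I.TwoCell f h where
  hom := A ◁ I.star ≫ η.pair γ
  bot_hom := by rw [← whiskerLeft_comp_assoc, I.bot_star]; simp [η.bot_hom]
  top_hom := by rw [← whiskerLeft_comp_assoc, I.top_star]; simp [γ.top_hom]

theorem id_comp {A B : C} {f g : A ⟶ B} (η : I.TwoCell f g) : (TwoCell.id f).comp η = η := by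
  have h : (TwoCell.id f).pair η = A ◁ I.glue (I.coid ≫ I.bot) (𝟙 X) (by
      rw [← Category.assoc, I.top_coid, Category.id_comp, Category.comp_id]) ≫ η.hom := by
    apply (I.isPushout_whiskerLeft A).hom_ext
    · rw [down_pair, ← whiskerLeft_comp_assoc, I.down_glue]; simp [η.bot_hom]
    · rw [up_pair, ← whiskerLeft_comp_assoc, I.up_glue]; simp
  ext
  rw [comp_hom, h, ← whiskerLeft_comp_assoc, I.counit_left]; simp

theorem comp_id {A B : C} {f g : A ⟶ B} (η : I.TwoCell f g) : η.comp (TwoCell.id g) = η := by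
  have h : η.pair (TwoCell.id g) = A ◁ I.glue (𝟙 X) (I.coid ≫ I.top) (by
      rw [← Category.assoc, I.bot_coid, Category.id_comp, Category.comp_id]) ≫ η.hom := by
    apply (I.isPushout_whiskerLeft A).hom_ext
    · rw [down_pair, ← whiskerLeft_comp_assoc, I.down_glue]; simp
    · rw [up_pair, ← whiskerLeft_comp_assoc, I.up_glue]; simp [η.top_hom]
  ext
  rw [comp_hom, h, ← whiskerLeft_comp_assoc, I.counit_right]; simp

theorem assoc [HasPushouts C] {A B : C} {f g h k : A ⟶ B} (η : I.TwoCell f g)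
    (γ : I.TwoCell g h) (χ : I.TwoCell h k) :
    (η.comp γ).comp χ = η.comp (γ.comp χ) := by
  have hp : IsPushout I.up I.down (pushout.inl I.up I.down) (pushout.inr I.up I.down) :=
    IsPushout.of_hasPushout _ _
  have : (tensorLeft A).IsLeftAdjoint := (ihom.adjunction A).isLeftAdjoint
  have hA : IsPushout (A ◁ I.up) (A ◁ I.down) (A ◁ pushout.inl I.up I.down)
      (A ◁ pushout.inr I.up I.down) := hp.map (tensorLeft A)
  let t : A ⊗ pushout I.up I.down ⟶ B := hA.desc (η.pair γ) (γ.pair χ) (by simp)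
  have t1 : A ◁ pushout.inl I.up I.down ≫ t = η.pair γ := IsPushout.inl_desc _ _ _ _
  have t2 : A ◁ pushout.inr I.up I.down ≫ t = γ.pair χ := IsPushout.inr_desc _ _ _ _
  have key := congrArg (fun s => A ◁ s ≫ t) (I.coassoc _ _ hp)
  simp only [MonoidalCategory.whiskerLeft_comp, Category.assoc] at key
  ext
  rw [comp_hom, comp_hom]
  refine Eq.trans ?_ (key.symm.trans ?_)
  · congr 1
    apply (I.isPushout_whiskerLeft A).hom_ext
    · rw [down_pair, ← whiskerLeft_comp_assoc, I.down_glue, comp_hom]; simp [t1]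
    · rw [up_pair, ← whiskerLeft_comp_assoc, I.up_glue]; simp [t2]
  · congr 1
    apply (I.isPushout_whiskerLeft A).hom_ext
    · rw [down_pair, ← whiskerLeft_comp_assoc, I.down_glue]; simp [t1]
    · rw [up_pair, ← whiskerLeft_comp_assoc, I.up_glue, comp_hom]; simp [t2]

end TwoCell

variable [MonoidalClosed C]

/-- The type of arrows `A ⟶ B`, as the type of objects of the category of arrows and homotopies. -/
@[nolint unusedArguments]
def HomCat (_ : Interval X) (A B : C) := A ⟶ B

/-- Arrows `A ⟶ B` and homotopies between them form a category. -/
instance [HasPushouts C] (A B : C) : Category (I.HomCat A B) where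
  Hom f g := I.TwoCell (A := A) (B := B) f g
  id f := TwoCell.id f
  comp η γ := η.comp γ
  id_comp := TwoCell.id_comp
  comp_id := TwoCell.comp_id
  assoc := TwoCell.assoc

/-- The 2-cell `η` is invertible in the category of arrows and homotopies. -/
def TwoCell.IsInvertible [HasPushouts C] {I : Interval X} {A B : C} {f g : A ⟶ B}
    (η : I.TwoCell f g) : Prop :=
  @IsIso (I.HomCat A B) _ f g η

/-! ### Representability -/

/-- The interchange law, by which the homotopies are the 2-cells of a (strict) 2-category. -/
def Interchange : Prop :=
  ∀ ⦃A B D : C⦄ ⦃f g : A ⟶ B⦄ ⦃h k : B ⟶ D⦄ (η : I.TwoCell f g) (γ : I.TwoCell h k),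
    (TwoCell.whiskerLeft f γ).comp (η.whiskerRight k) =
      (η.whiskerRight h).comp (TwoCell.whiskerLeft g γ)

/-- The object `P` with the 2-cell `l : p₀ ⟹ p₁ : P ⟶ A` is a cotensor of `A` with the category
`𝟚`: for every `B`, the functor from the hom-category of `(B, P)` to the arrow category of the
hom-category of `(B, A)` given by composition with `l` is bijective on objects and on arrows. -/
structure IsCotensorTwo {P A : C} {p₀ p₁ : P ⟶ A} (l : I.TwoCell p₀ p₁) : Prop where
  one_dim : ∀ ⦃B : C⦄ ⦃f g : B ⟶ A⦄ (φ : I.TwoCell f g), ∃! h : B ⟶ P, h ▷ X ≫ l.hom = φ.hom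
  two_dim : ∀ ⦃B : C⦄ ⦃h k : B ⟶ P⦄ (γ : I.TwoCell (h ≫ p₀) (k ≫ p₀))
    (δ : I.TwoCell (h ≫ p₁) (k ≫ p₁)),
    γ.comp (TwoCell.whiskerLeft k l) = (TwoCell.whiskerLeft h l).comp δ →
    ∃! θ : I.TwoCell h k, θ.whiskerRight p₀ = γ ∧ θ.whiskerRight p₁ = δ

/-- `I` is representable: it makes the ambient category a 2-category, and this 2-category has
cotensors with `𝟚`. -/
structure Representable : Prop where
  interchange : I.Interchange
  cotensor : ∀ A : C, ∃ (P : C) (p₀ p₁ : P ⟶ A) (l : I.TwoCell p₀ p₁), I.IsCotensorTwo l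

/-! ### The isofibration model structure -/

section ModelStructure

variable [HasPushouts C]

/-- Weak equivalences: the categorical equivalences of the induced 2-category. -/
def weakEquivalences : MorphismProperty C := fun A B f =>
  ∃ g : B ⟶ A, Nonempty (@Iso (I.HomCat A A) _ (f ≫ g) (𝟙 A)) ∧
    Nonempty (@Iso (I.HomCat B B) _ (g ≫ f) (𝟙 B))

/-- Fibrations: maps `p : A ⟶ B` such that, for every `E`, composition with `p` is an isofibration
from the hom-category of `(E, A)` to that of `(E, B)`. -/
def fibrations : MorphismProperty C := fun A B p =>
  ∀ ⦃E : C⦄ (h : E ⟶ A) (k : E ⟶ B) (φ : I.TwoCell k (h ≫ p)), φ.IsInvertible →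
    ∃ (k' : E ⟶ A) (ψ : I.TwoCell k' h), ψ.IsInvertible ∧ k' ≫ p = k ∧
      (ψ.whiskerRight p).hom = φ.hom

/-- Cofibrations: maps with the left lifting property against the maps that are both fibrations
and weak equivalences. -/
def cofibrations : MorphismProperty C := (I.fibrations ⊓ I.weakEquivalences).llp

end ModelStructure

end Monoidal

end Cocategory

/-! ### Commutative Hopf objects -/

/-- A commutative Hopf object structure on `Y`: a commutative monoid and a comonoid whose
multiplication and unit are comonoid homomorphisms. -/
structure CommHopf {C : Type u} [Category.{v} C] [MonoidalCategory C] [BraidedCategory C]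
    (Y : C) where
  bimon : BimonObj Y
  comm : IsCommMonObj Y

namespace CommHopf

variable {C : Type u} [Category.{v} C] [MonoidalCategory C]

section

variable [BraidedCategory C]

def mul {Y : C} (S : CommHopf Y) : Y ⊗ Y ⟶ Y := S.bimon.mul

def one {Y : C} (S : CommHopf Y) : 𝟙_ C ⟶ Y := S.bimon.one

def comul {Y : C} (S : CommHopf Y) : Y ⟶ Y ⊗ Y := S.bimon.comul

def counit {Y : C} (S : CommHopf Y) : Y ⟶ 𝟙_ C := S.bimon.counit

/-- Morphisms of Hopf objects: monoid homomorphisms that are comonoid homomorphisms. -/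
def IsHom {Y Z : C} (S : CommHopf Y) (T : CommHopf Z) (f : Y ⟶ Z) : Prop :=
  letI := S.bimon
  letI := T.bimon
  IsBimonHom f

/-- The trivial Hopf object structure on the tensor unit. -/
def unit (C : Type u) [Category.{v} C] [MonoidalCategory C] [BraidedCategory C] :
    CommHopf (𝟙_ C) where
  bimon :=
    { one := 𝟙 _
      mul := (λ_ _).hom
      one_mul := by monoidal_coherence
      mul_one := by monoidal_coherence
      mul_assoc := by monoidal_coherence
      counit := 𝟙 _
      comul := (λ_ _).inv
      counit_comul := by monoidal_coherence
      comul_counit := by monoidal_coherence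
      comul_assoc := by monoidal_coherence
      mul_comul := by
        rw [MonoidalCategory.tensorHom_def (λ_ (𝟙_ C)).inv, Category.assoc, unitors_equal,
          ← tensor_right_unitality]
        monoidal_coherence
      one_comul := by
        change 𝟙 _ ≫ (λ_ (𝟙_ C)).inv = (λ_ (𝟙_ C)).inv ≫ (𝟙 _ ⊗ₘ 𝟙 _)
        simp
      mul_counit := by
        change (λ_ (𝟙_ C)).hom ≫ 𝟙 _ = (𝟙 _ ⊗ₘ 𝟙 _) ≫ (λ_ (𝟙_ C)).hom
        simp
      one_counit := by simp }
  comm := { mul_comm := (IsCommMonObj.mul_comm (𝟙_ C) :) }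

end

section TwoPoints

variable (C) [HasBinaryCoproducts C]

/-- The object `U + U`. -/
abbrev twoPt : C := 𝟙_ C ⨿ 𝟙_ C

/-- The point `⊥` of `U + U`, the left coproduct injection. -/
def botPt : 𝟙_ C ⟶ twoPt C := coprod.inl

/-- The point `⊤` of `U + U`, the right coproduct injection. -/
def topPt : 𝟙_ C ⟶ twoPt C := coprod.inr

/-- The codiagonal `U + U ⟶ U`. -/
def fold : twoPt C ⟶ 𝟙_ C := coprod.desc (𝟙 _) (𝟙 _)

/-- The comultiplication of `U + U`, sending each of the two points `x` to `x ⊗ x`. -/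
def twoPtComul : twoPt C ⟶ twoPt C ⊗ twoPt C :=
  coprod.desc ((λ_ _).inv ≫ (botPt C ⊗ₘ botPt C)) ((λ_ _).inv ≫ (topPt C ⊗ₘ topPt C))

@[simp]
theorem bot_fold : botPt C ≫ fold C = 𝟙 _ := coprod.inl_desc _ _

@[simp]
theorem bot_fold_assoc {Z : C} (t : 𝟙_ C ⟶ Z) : botPt C ≫ fold C ≫ t = t := by
  rw [← Category.assoc, bot_fold, Category.id_comp]

@[simp]
theorem top_fold : topPt C ≫ fold C = 𝟙 _ := coprod.inr_desc _ _

@[simp]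
theorem top_fold_assoc {Z : C} (t : 𝟙_ C ⟶ Z) : topPt C ≫ fold C ≫ t = t := by
  rw [← Category.assoc, top_fold, Category.id_comp]

@[simp]
theorem bot_comul : botPt C ≫ twoPtComul C = (λ_ _).inv ≫ (botPt C ⊗ₘ botPt C) :=
  coprod.inl_desc _ _

@[simp]
theorem bot_comul_assoc {Z : C} (t : twoPt C ⊗ twoPt C ⟶ Z) :
    botPt C ≫ twoPtComul C ≫ t = (λ_ _).inv ≫ (botPt C ⊗ₘ botPt C) ≫ t := by
  rw [← Category.assoc, bot_comul, Category.assoc]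

@[simp]
theorem top_comul : topPt C ≫ twoPtComul C = (λ_ _).inv ≫ (topPt C ⊗ₘ topPt C) :=
  coprod.inr_desc _ _

@[simp]
theorem top_comul_assoc {Z : C} (t : twoPt C ⊗ twoPt C ⟶ Z) :
    topPt C ≫ twoPtComul C ≫ t = (λ_ _).inv ≫ (topPt C ⊗ₘ topPt C) ≫ t := by
  rw [← Category.assoc, top_comul, Category.assoc]

variable {C} in
theorem twoPt_ext {Z : C} {f g : twoPt C ⟶ Z} (hl : botPt C ≫ f = botPt C ≫ g)
    (hr : topPt C ≫ f = topPt C ≫ g) : f = g :=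
  coprod.hom_ext hl hr

theorem comul_fold :
    twoPtComul C ≫ (fold C ⊗ₘ fold C) = fold C ≫ (λ_ _).inv := by
  apply twoPt_ext <;> simp

theorem comul_fold_assoc {Z : C} (t : 𝟙_ C ⊗ 𝟙_ C ⟶ Z) :
    twoPtComul C ≫ (fold C ⊗ₘ fold C) ≫ t = fold C ≫ (λ_ _).inv ≫ t := by
  rw [← Category.assoc, comul_fold, Category.assoc]

variable [MonoidalClosed C]

variable {C} in
theorem whiskerLeft_twoPt_ext {A Z : C} {f g : A ⊗ twoPt C ⟶ Z}
    (hl : A ◁ botPt C ≫ f = A ◁ botPt C ≫ g)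
    (hr : A ◁ topPt C ≫ f = A ◁ topPt C ≫ g) : f = g := by
  apply MonoidalClosed.curry_injective
  apply twoPt_ext
  · rw [← MonoidalClosed.curry_natural_left, ← MonoidalClosed.curry_natural_left, hl]
  · rw [← MonoidalClosed.curry_natural_left, ← MonoidalClosed.curry_natural_left, hr]

/-- The meet operation of `U + U`, given by `x ∧ ⊥ = ⊥` and `x ∧ ⊤ = x`. -/
def twoPtMeet : twoPt C ⊗ twoPt C ⟶ twoPt C :=
  MonoidalClosed.uncurry (coprod.desc
    (MonoidalClosed.curry ((ρ_ _).hom ≫ fold C ≫ botPt C))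
    (MonoidalClosed.curry (ρ_ _).hom))

@[simp]
theorem bot_meet : twoPt C ◁ botPt C ≫ twoPtMeet C = (ρ_ _).hom ≫ fold C ≫ botPt C := by
  rw [twoPtMeet, ← MonoidalClosed.uncurry_natural_left, botPt, coprod.inl_desc,
    MonoidalClosed.uncurry_curry]

@[simp]
theorem bot_meet_assoc {Z : C} (t : twoPt C ⟶ Z) :
    twoPt C ◁ botPt C ≫ twoPtMeet C ≫ t = (ρ_ _).hom ≫ fold C ≫ botPt C ≫ t := by
  rw [← Category.assoc, bot_meet]
  simp

@[simp]
theorem top_meet : twoPt C ◁ topPt C ≫ twoPtMeet C = (ρ_ _).hom := by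
  rw [twoPtMeet, ← MonoidalClosed.uncurry_natural_left, topPt, coprod.inr_desc,
    MonoidalClosed.uncurry_curry]

@[simp]
theorem top_meet_assoc {Z : C} (t : twoPt C ⟶ Z) :
    twoPt C ◁ topPt C ≫ twoPtMeet C ≫ t = (ρ_ _).hom ≫ t := by
  rw [← Category.assoc, top_meet]

theorem meet_fold : twoPtMeet C ≫ fold C = (fold C ⊗ₘ fold C) ≫ (λ_ _).hom := by
  apply whiskerLeft_twoPt_ext
  · rw [bot_meet_assoc, MonoidalCategory.tensorHom_def', Category.assoc, ← whiskerLeft_comp_assoc,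
      bot_fold]
    simp [unitors_equal]
  · rw [top_meet_assoc, MonoidalCategory.tensorHom_def', Category.assoc, ← whiskerLeft_comp_assoc,
      top_fold]
    simp [unitors_equal]

theorem meet_fold_assoc {Z : C} (t : 𝟙_ C ⟶ Z) :
    twoPtMeet C ≫ fold C ≫ t = (fold C ⊗ₘ fold C) ≫ (λ_ _).hom ≫ t := by
  rw [← Category.assoc, meet_fold, Category.assoc]

theorem whiskerRight_top_meet : topPt C ▷ twoPt C ≫ twoPtMeet C = (λ_ _).hom := by
  apply whiskerLeft_twoPt_ext
  · rw [whisker_exchange_assoc, bot_meet]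
    simp [unitors_equal]
  · rw [whisker_exchange_assoc, top_meet]
    simp [unitors_equal]

theorem whiskerRight_bot_meet :
    botPt C ▷ twoPt C ≫ twoPtMeet C = (λ_ _).hom ≫ fold C ≫ botPt C := by
  apply whiskerLeft_twoPt_ext
  · rw [whisker_exchange_assoc, bot_meet]
    simp [unitors_equal]
  · rw [whisker_exchange_assoc, top_meet]
    simp [unitors_equal]

theorem meet_assoc : twoPtMeet C ▷ twoPt C ≫ twoPtMeet C =
    (α_ _ _ _).hom ≫ twoPt C ◁ twoPtMeet C ≫ twoPtMeet C := by
  apply whiskerLeft_twoPt_ext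
  · rw [whisker_exchange_assoc, bot_meet, associator_naturality_right_assoc,
      ← whiskerLeft_comp_assoc, bot_meet]
    simp only [rightUnitor_naturality_assoc, meet_fold_assoc, MonoidalCategory.whiskerLeft_comp,
      Category.assoc, bot_meet, MonoidalCategory.tensorHom_def']
    simp [unitors_equal]
  · rw [whisker_exchange_assoc, top_meet, associator_naturality_right_assoc,
      ← whiskerLeft_comp_assoc, top_meet]
    simp

variable [SymmetricCategory C]

theorem braiding_meet : (β_ (twoPt C) (twoPt C)).hom ≫ twoPtMeet C = twoPtMeet C := by
  apply whiskerLeft_twoPt_ext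
  · rw [BraidedCategory.braiding_naturality_right_assoc, whiskerRight_bot_meet, bot_meet]
    simp
  · rw [BraidedCategory.braiding_naturality_right_assoc, whiskerRight_top_meet, top_meet]
    simp

theorem meet_comul : twoPtMeet C ≫ twoPtComul C =
    (twoPtComul C ⊗ₘ twoPtComul C) ≫ tensorμ _ _ _ _ ≫ (twoPtMeet C ⊗ₘ twoPtMeet C) := by
  have aux (x : 𝟙_ C ⟶ twoPt C) (y : twoPt C ⟶ twoPt C)
      (hx : x ≫ twoPtComul C = (λ_ _).inv ≫ (x ⊗ₘ x))
      (hy : twoPt C ◁ x ≫ twoPtMeet C = (ρ_ _).hom ≫ y)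
      (hy' : y ≫ twoPtComul C = twoPtComul C ≫ (y ⊗ₘ y)) :
      twoPt C ◁ x ≫ twoPtMeet C ≫ twoPtComul C = twoPt C ◁ x ≫ (twoPtComul C ⊗ₘ twoPtComul C) ≫
        tensorμ _ _ _ _ ≫ (twoPtMeet C ⊗ₘ twoPtMeet C) := by
    rw [reassoc_of% hy, hy', whiskerLeft_comp_tensorHom_assoc, hx,
      MonoidalCategory.tensorHom_def (twoPtComul C), MonoidalCategory.whiskerLeft_comp]
    simp only [Category.assoc]
    rw [tensorμ_natural_right_assoc, tensorHom_comp_tensorHom, hy,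
      ← tensorHom_comp_tensorHom, ← tensor_right_unitality_assoc, rightUnitor_naturality_assoc]
  apply whiskerLeft_twoPt_ext
  · refine aux _ (fold C ≫ botPt C) (bot_comul C) (bot_meet C) ?_
    rw [Category.assoc, bot_comul, ← tensorHom_comp_tensorHom, comul_fold_assoc]
  · refine aux _ (𝟙 _) (top_comul C) ?_ ?_ <;> simp

/-- The meet Hopf object structure on `U + U`. -/
def twoPoints : CommHopf (twoPt C) where
  bimon :=
    { one := topPt C
      mul := twoPtMeet C
      one_mul := whiskerRight_top_meet C
      mul_one := top_meet C
      mul_assoc := meet_assoc C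
      counit := fold C
      comul := twoPtComul C
      counit_comul := by
        apply twoPt_ext
        · rw [bot_comul_assoc, MonoidalCategory.tensorHom_def', Category.assoc, ← comp_whiskerRight]
          simp
        · rw [top_comul_assoc, MonoidalCategory.tensorHom_def', Category.assoc, ← comp_whiskerRight]
          simp
      comul_counit := by
        apply twoPt_ext
        · rw [bot_comul_assoc, MonoidalCategory.tensorHom_def, Category.assoc, ← MonoidalCategory.whiskerLeft_comp]
          simp [unitors_inv_equal]
        · rw [top_comul_assoc, MonoidalCategory.tensorHom_def, Category.assoc, ← MonoidalCategory.whiskerLeft_comp]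
          simp [unitors_inv_equal]
      comul_assoc := by
        have aux (x : 𝟙_ C ⟶ twoPt C) (hx : x ≫ twoPtComul C = (λ_ _).inv ≫ (x ⊗ₘ x)) :
            x ≫ twoPtComul C ≫ twoPt C ◁ twoPtComul C =
              x ≫ twoPtComul C ≫ twoPtComul C ▷ twoPt C ≫ (α_ _ _ _).hom := by
          rw [reassoc_of% hx, reassoc_of% hx, tensorHom_comp_whiskerLeft,
            tensorHom_comp_whiskerRight_assoc, hx]
          have e1 : (x ⊗ₘ (λ_ (𝟙_ C)).inv ≫ (x ⊗ₘ x)) =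
              𝟙_ C ◁ (λ_ (𝟙_ C)).inv ≫ (x ⊗ₘ (x ⊗ₘ x)) := by
            rw [whiskerLeft_comp_tensorHom]
          have e2 : ((λ_ (𝟙_ C)).inv ≫ (x ⊗ₘ x) ⊗ₘ x) =
              (λ_ (𝟙_ C)).inv ▷ 𝟙_ C ≫ ((x ⊗ₘ x) ⊗ₘ x) := by
            rw [whiskerRight_comp_tensorHom]
          rw [e1, e2, Category.assoc, associator_naturality]
          simp only [← Category.assoc]
          congr 1
          monoidal_coherence
        exact twoPt_ext (aux _ (bot_comul C)) (aux _ (top_comul C))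
      mul_comul := meet_comul C
      one_comul := top_comul C
      mul_counit := meet_fold C
      one_counit := top_fold C }
  comm :=
    letI : MonObj (twoPt C) := 
     { one := topPt C
       mul := twoPtMeet C
       one_mul := whiskerRight_top_meet C
       mul_one := top_meet C
       mul_assoc := meet_assoc C }
    { mul_comm := braiding_meet C }

end TwoPoints

end CommHopf

/-! ### The free invertible interval -/

namespace Cocategory

variable {C : Type u} [Category.{v} C] [MonoidalCategory C] [HasFiniteColimits C] {X : C}
  (I : Interval X)

/-- The pushout of `[⊥, ⊤] : U + U ⟶ I` along `[⊤, ⊥] : U + U ⟶ I`. -/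
def kObj : C := pushout (coprod.desc I.bot I.top) (coprod.desc I.top I.bot)

/-- The first copy of `I` in `K`. -/
def kInl : X ⟶ I.kObj := pushout.inl _ _

/-- The second, reversed, copy of `I` in `K`. -/
def kInr : X ⟶ I.kObj := pushout.inr _ _

theorem kCondition : coprod.desc I.bot I.top ≫ I.kInl = coprod.desc I.top I.bot ≫ I.kInr :=
  pushout.condition

theorem bot_kInl : I.bot ≫ I.kInl = I.top ≫ I.kInr := by
  have h := congrArg (coprod.inl ≫ ·) I.kCondition
  rwa [← Category.assoc, ← Category.assoc, coprod.inl_desc, coprod.inl_desc] at h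

theorem top_kInl : I.top ≫ I.kInl = I.bot ≫ I.kInr := by
  have h := congrArg (coprod.inr ≫ ·) I.kCondition
  rwa [← Category.assoc, ← Category.assoc, coprod.inr_desc, coprod.inr_desc] at h

/-- The map `[f, g] : K ⟶ Z`. -/
def kDesc {Z : C} (f g : X ⟶ Z) (hb : I.bot ≫ f = I.top ≫ g) (ht : I.top ≫ f = I.bot ≫ g) :
    I.kObj ⟶ Z :=
  pushout.desc f g (by apply coprod.hom_ext <;> simp [hb, ht])

@[simp]
theorem kInl_kDesc {Z : C} (f g : X ⟶ Z) (hb : I.bot ≫ f = I.top ≫ g)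
    (ht : I.top ≫ f = I.bot ≫ g) : I.kInl ≫ I.kDesc f g hb ht = f :=
  pushout.inl_desc _ _ _

@[simp]
theorem kInr_kDesc {Z : C} (f g : X ⟶ Z) (hb : I.bot ≫ f = I.top ≫ g)
    (ht : I.top ≫ f = I.bot ≫ g) : I.kInr ≫ I.kDesc f g hb ht = g :=
  pushout.inr_desc _ _ _

def kBot : 𝟙_ C ⟶ I.kObj := I.bot ≫ I.kInl

def kTop : 𝟙_ C ⟶ I.kObj := I.top ≫ I.kInl

/-- The coidentity map of `K`. -/
def kCoid : I.kObj ⟶ 𝟙_ C :=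
  I.kDesc I.coid I.coid (by rw [I.bot_coid, I.top_coid]) (by rw [I.bot_coid, I.top_coid])

/-- The map `K ⟶ K` interchanging the two copies of `I`. -/
def kSymm : I.kObj ⟶ I.kObj := I.kDesc I.kInr I.kInl I.top_kInl.symm I.bot_kInl.symm

theorem kBot_kSymm : I.kBot ≫ I.kSymm = I.kTop := by
  rw [kBot, kSymm, Category.assoc, kInl_kDesc, kTop, top_kInl]

theorem kTop_kSymm : I.kTop ≫ I.kSymm = I.kBot := by
  rw [kTop, kSymm, Category.assoc, kInl_kDesc, kBot, bot_kInl]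

/-- The object of cocomposable coarrows of `K`. -/
def kObj₂ : C := pushout I.kTop I.kBot

def kDown : I.kObj ⟶ I.kObj₂ := pushout.inl _ _

def kUp : I.kObj ⟶ I.kObj₂ := pushout.inr _ _

theorem kTop_kDown : I.kTop ≫ I.kDown = I.kBot ≫ I.kUp := pushout.condition

/-- The map `[h, k] : K₂ ⟶ Z`. -/
def kGlue {Z : C} (h k : I.kObj ⟶ Z) (w : I.kTop ≫ h = I.kBot ≫ k) : I.kObj₂ ⟶ Z :=
  pushout.desc h k w

theorem kStar_aux₁ : I.top ≫ I.kInl ≫ I.kDown = I.bot ≫ I.kInl ≫ I.kUp := by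
  simpa only [kTop, kBot, Category.assoc] using I.kTop_kDown

theorem kStar_aux₂ : I.top ≫ I.kInr ≫ I.kUp = I.bot ≫ I.kInr ≫ I.kDown := by
  rw [← Category.assoc, ← bot_kInl, ← Category.assoc I.bot I.kInr, ← top_kInl, Category.assoc,
    Category.assoc]
  exact I.kStar_aux₁.symm

/-- The cocomposition map of `K`: that of `I` on the first copy, and the reverse of that of `I` on
the second copy. -/
def kStar : I.kObj ⟶ I.kObj₂ :=
  I.kDesc
    (I.star ≫ I.glue (I.kInl ≫ I.kDown) (I.kInl ≫ I.kUp) I.kStar_aux₁)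
    (I.star ≫ I.glue (I.kInr ≫ I.kUp) (I.kInr ≫ I.kDown) I.kStar_aux₂)
    (by
      rw [← Category.assoc, I.bot_star, Category.assoc, I.down_glue,
        ← Category.assoc I.top I.star, I.top_star, Category.assoc, I.up_glue, ← Category.assoc,
        ← Category.assoc, I.bot_kInl])
    (by
      rw [← Category.assoc, I.top_star, Category.assoc, I.up_glue,
        ← Category.assoc I.bot I.star, I.bot_star, Category.assoc, I.down_glue, ← Category.assoc,
        ← Category.assoc, I.top_kInl])

/-- The object of coarrows `J` of the free invertible interval generated by `I`: the quotient of
`K` by the relations `[σ, K] ∘ ⋆ = ⊤ ∘ i` and `[K, σ] ∘ ⋆ = ⊥ ∘ i`. -/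
def freeObj : C :=
  coequalizer
    (coprod.desc
      (I.kStar ≫ I.kGlue I.kSymm (𝟙 _) (by rw [kTop_kSymm, Category.comp_id]))
      (I.kStar ≫ I.kGlue (𝟙 _) I.kSymm (by rw [kBot_kSymm, Category.comp_id])))
    (coprod.desc (I.kCoid ≫ I.kTop) (I.kCoid ≫ I.kBot))

/-- The quotient map `K ⟶ J`. -/
def freeQuot : I.kObj ⟶ I.freeObj := coequalizer.π _ _

/-- The canonical map `I ⟶ J`. -/
def freeIncl : X ⟶ I.freeObj := I.kInl ≫ I.freeQuot

/-- The structure maps of the interval `J` are induced by those of `K` along the quotient map. -/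
structure IsQuotientStructure (J : Interval I.freeObj) : Prop where
  bot : I.kBot ≫ I.freeQuot = J.bot
  top : I.kTop ≫ I.freeQuot = J.top
  coid : I.freeQuot ≫ J.coid = I.kCoid
  star : I.freeQuot ≫ J.star =
    I.kStar ≫ I.kGlue (I.freeQuot ≫ J.down) (I.freeQuot ≫ J.up)
      (by rw [← Category.assoc, top, J.isPushout.w, ← bot, Category.assoc])

end Cocategory

/-! ### Hopf intervals -/

namespace Cocategory

section

variable {C : Type u} [Category.{v} C] [MonoidalCategory C] {X : C} (I : Interval X)

/-- `m` is the meet operation of `I`: both `m` and its composite with the symmetry are homotopies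
from `⊥ ∘ i` to the identity. -/
structure IsMeet (m : X ⊗ X ⟶ X) : Prop where
  bot_right : X ◁ I.bot ≫ m = (ρ_ X).hom ≫ I.coid ≫ I.bot
  top_right : X ◁ I.top ≫ m = (ρ_ X).hom
  bot_left : I.bot ▷ X ≫ m = (λ_ X).hom ≫ I.coid ≫ I.bot
  top_left : I.top ▷ X ≫ m = (λ_ X).hom

/-- `S` is the structure `(Δ, i, ∧, ⊤)` on the interval `I`. -/
structure IsMeetHopf [BraidedCategory C] (S : CommHopf X) : Prop where
  comul : S.comul = I.comul
  counit : S.counit = I.coid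
  mul : I.IsMeet S.mul
  one : S.one = I.top

end

/-- The commutative Hopf object `(H, S)` with the maps `incl : U + U ⟶ H` and `proj : H ⟶ U` is a
commutative Hopf interval in the isofibration model structure: a cylinder object on `U` whose
structure maps are morphisms of Hopf objects. -/
structure IsHopfInterval {C : Type u} [Category.{v} C] [MonoidalCategory C] [SymmetricCategory C]
    [MonoidalClosed C] [HasFiniteColimits C] {X : C} (I : Interval X) {H : C} (S : CommHopf H)
    (incl : 𝟙_ C ⨿ 𝟙_ C ⟶ H) (proj : H ⟶ 𝟙_ C) : Prop where
  fac : incl ≫ proj = coprod.desc (𝟙 _) (𝟙 _)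
  cofibration : I.cofibrations incl
  weakEquivalence : I.weakEquivalences proj
  incl_hom : (CommHopf.twoPoints C).IsHom S incl
  proj_hom : S.IsHom (CommHopf.unit C) proj

end Cocategory

end StrictInterval

end

noncomputable section

namespace StrictInterval

namespace Cocategory

/-! ### Composition of paths -/

section Paths

variable {C : Type u} [Category.{v} C] {C₀ C₁ : C} (P : Cocategory C₀ C₁)

/-! Two facts carry the proof: representability controls squares, and `J` classifies invertible
2-cells.

Squares. Let `P` be the cotensor of `Z` with `𝟚`. A map `(A ⊗ I) ⊗ I ⟶ Z` is the same as a map `A ⊗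
I ⟶ P`, that is, a 2-cell between arrows `A ⟶ P`, and hence the same as a commuting square of
2-cells between arrows `A ⟶ Z`. So such maps are determined by their four faces
(`Representable.square_ext`), and every commuting square has a filler
(`Representable.square_exists`). The meet of `I` fills the square whose sides are the constant path
at `⊥` and the identity path. Its uniqueness and the Hopf axioms involving it are checked on faces;
the comonoid axioms follow from the cocategory axioms alone.

Invertible 2-cells. Maps out of `J` are pairs of mutually inverse `I`-paths. By closedness, maps `A
⊗ J ⟶ Z` are the invertible 2-cells between arrows `A ⟶ Z`: a 2-cell is invertible iff it extends
along `A ◁ ι`. The extension is unique because inverses are unique, so `A ◁ ι` is epi. Hence every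
equation about `J` can be tested on `I`, and only existence of maps out of `J` and its tensor powers
needs an argument. The interval structure of `J` exists because a composite of invertible paths is
invertible.

The meet of `J`. A 2-cell between arrows out of `A ⊗ I` is invertible once its restrictions to both
ends of the cylinder are (`Representable.isInvertible_of_faces`), since the inverse can be
constructed as a filler. The map `m ≫ ι` has the ends "constant at `⊥`" and `ι` in each variable,
both of which extend over `J`; so it extends first in one variable and then in the other.

Model structure. Postcomposition with a weak equivalence is fully faithful on hom-categories.
Invertible paths therefore lift strictly, with given endpoints, along weak equivalences, which makes
`[⊥, ⊤]` a cofibration. The meet of `J`, restricted along `J ◁ ι`, is an invertible 2-cell from `⊥ ∘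
i` to the identity, so `i` is a weak equivalence.

Freeness. A Hopf morphism `ξ : I ⟶ H` preserves counits, and the projection of a Hopf interval is
its counit. So the projection sends `ξ` to a constant path; being a weak equivalence it reflects
invertibility, and `ξ` extends over `J`. -/

theorem glue_ext {Z : C} {f g : P.C₂ ⟶ Z} (h₁ : P.down ≫ f = P.down ≫ g)
    (h₂ : P.up ≫ f = P.up ≫ g) : f = g :=
  P.isPushout.hom_ext h₁ h₂

/-- The matching condition is an argument of `glue` that depends on both maps, so changing either of
them requires transporting it. -/
theorem glue_congr {Z : C} {h k h' k' : C₁ ⟶ Z} (w : P.top ≫ h = P.bot ≫ k) (e₁ : h = h')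
    (e₂ : k = k') : P.glue h k w = P.glue h' k' (by rw [← e₁, ← e₂, w]) := by
  subst e₁ e₂
  rfl

theorem glue_comp {Z W : C} (h k : C₁ ⟶ Z) (w : P.top ≫ h = P.bot ≫ k) (t : Z ⟶ W) :
    P.glue h k w ≫ t = P.glue (h ≫ t) (k ≫ t) (by rw [reassoc_of% w]) := by
  apply P.glue_ext
  · rw [← Category.assoc, P.down_glue, P.down_glue]
  · rw [← Category.assoc, P.up_glue, P.up_glue]

/-- `P.star ≫ P.glue h k w` is the concatenation of paths in `Z`, first `h` and then `k`. This lemma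
and the next ones dualize the cocategory axioms into the axioms of a category of paths. -/
theorem bot_star_glue {Z : C} (h k : C₁ ⟶ Z) (w : P.top ≫ h = P.bot ≫ k) :
    P.bot ≫ P.star ≫ P.glue h k w = P.bot ≫ h := by
  rw [← Category.assoc, P.bot_star, Category.assoc, P.down_glue]

theorem top_star_glue {Z : C} (h k : C₁ ⟶ Z) (w : P.top ≫ h = P.bot ≫ k) :
    P.top ≫ P.star ≫ P.glue h k w = P.top ≫ k := by
  rw [← Category.assoc, P.top_star, Category.assoc, P.up_glue]

theorem star_glue_id_left {Z : C} (k : C₁ ⟶ Z)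
    (w : P.top ≫ P.coid ≫ P.bot ≫ k = P.bot ≫ k) :
    P.star ≫ P.glue (P.coid ≫ P.bot ≫ k) k w = k := by
  have h := congrArg (· ≫ k) P.counit_left
  simpa [glue_comp] using h

theorem star_glue_id_right {Z : C} (k : C₁ ⟶ Z)
    (w : P.top ≫ k = P.bot ≫ P.coid ≫ P.top ≫ k) :
    P.star ≫ P.glue k (P.coid ≫ P.top ≫ k) w = k := by
  have h := congrArg (· ≫ k) P.counit_right
  simpa [glue_comp] using h

/-- Coassociativity, taken on the pushout of cocomposable triples and followed by the map `t` that
restricts to the three given paths. -/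
theorem star_glue_assoc [HasPushouts C] {Z : C} (f g h : C₁ ⟶ Z) (w₁ : P.top ≫ f = P.bot ≫ g)
    (w₂ : P.top ≫ g = P.bot ≫ h) :
    P.star ≫ P.glue f (P.star ≫ P.glue g h w₂) (by rw [bot_star_glue, w₁]) =
      P.star ≫ P.glue (P.star ≫ P.glue f g w₁) h (by rw [top_star_glue, w₂]) := by
  have hp : IsPushout P.up P.down (pushout.inl P.up P.down) (pushout.inr P.up P.down) :=
    IsPushout.of_hasPushout _ _
  let t := hp.desc (P.glue f g w₁) (P.glue g h w₂) (by simp)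
  have t1 : pushout.inl P.up P.down ≫ t = P.glue f g w₁ := IsPushout.inl_desc _ _ _ _
  have t2 : pushout.inr P.up P.down ≫ t = P.glue g h w₂ := IsPushout.inr_desc _ _ _ _
  have key := congrArg (· ≫ t) (P.coassoc _ _ hp)
  simpa only [Category.assoc, glue_comp, t1, t2, P.down_glue, P.up_glue] using key

end Paths

/-! ### Ends of cylinders and the calculus of 2-cells -/

section Monoidal

variable {C : Type u} [Category.{v} C] [MonoidalCategory C] {X : C} (I : Interval X)

/-- The initial inclusion `A ⟶ A ⊗ X`. -/
def botFace (A : C) : A ⟶ A ⊗ X := (ρ_ A).inv ≫ A ◁ I.bot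

/-- The final inclusion `A ⟶ A ⊗ X`. -/
def topFace (A : C) : A ⟶ A ⊗ X := (ρ_ A).inv ≫ A ◁ I.top

theorem botFace_naturality {A B : C} (f : A ⟶ B) :
    I.botFace A ≫ f ▷ X = f ≫ I.botFace B := by
  rw [botFace, botFace, Category.assoc, whisker_exchange, rightUnitor_inv_naturality_assoc]

theorem topFace_naturality {A B : C} (f : A ⟶ B) :
    I.topFace A ≫ f ▷ X = f ≫ I.topFace B := by
  rw [topFace, topFace, Category.assoc, whisker_exchange, rightUnitor_inv_naturality_assoc]

theorem whiskerLeft_bot_eq {A Z : C} (t : A ⊗ X ⟶ Z) :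
    A ◁ I.bot ≫ t = (ρ_ A).hom ≫ I.botFace A ≫ t := by
  simp [botFace]

theorem whiskerLeft_top_eq {A Z : C} (t : A ⊗ X ⟶ Z) :
    A ◁ I.top ≫ t = (ρ_ A).hom ≫ I.topFace A ≫ t := by
  simp [topFace]

namespace TwoCell

variable {I}

theorem botFace_hom {A B : C} {f g : A ⟶ B} (η : I.TwoCell f g) : I.botFace A ≫ η.hom = f := by
  rw [botFace, Category.assoc, η.bot_hom, Iso.inv_hom_id_assoc]

theorem topFace_hom {A B : C} {f g : A ⟶ B} (η : I.TwoCell f g) : I.topFace A ≫ η.hom = g := by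
  rw [topFace, Category.assoc, η.top_hom, Iso.inv_hom_id_assoc]

variable (I) in
/-- A map `A ⊗ X ⟶ B` as a 2-cell with prescribed ends. -/
@[simps]
def mk' {A B : C} {f g : A ⟶ B} (t : A ⊗ X ⟶ B) (hf : I.botFace A ≫ t = f)
    (hg : I.topFace A ≫ t = g) : I.TwoCell f g where
  hom := t
  bot_hom := by rw [whiskerLeft_bot_eq, hf]
  top_hom := by rw [whiskerLeft_top_eq, hg]

variable (I) in
/-- The universal 2-cell out of `A`. -/
def generic (A : C) : I.TwoCell (I.botFace A) (I.topFace A) :=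
  mk' I (𝟙 _) (Category.comp_id _) (Category.comp_id _)

@[simp]
theorem generic_hom (A : C) : (generic I A).hom = 𝟙 _ := rfl

theorem id_whiskerRight {A B D : C} (f : A ⟶ B) (k : B ⟶ D) :
    (TwoCell.id (I := I) f).whiskerRight k = TwoCell.id (f ≫ k) := by
  ext
  simp

theorem whiskerLeft_id {A B D : C} (k : A ⟶ B) (f : B ⟶ D) :
    whiskerLeft k (TwoCell.id (I := I) f) = TwoCell.id (k ≫ f) := by
  ext
  simp only [whiskerLeft_hom, id_hom]
  rw [← whisker_exchange_assoc]
  simp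

variable [MonoidalClosed C]

theorem pair_ext {A Z : C} {f g : A ⊗ I.C₂ ⟶ Z} (h₁ : A ◁ I.down ≫ f = A ◁ I.down ≫ g)
    (h₂ : A ◁ I.up ≫ f = A ◁ I.up ≫ g) : f = g :=
  (I.isPushout_whiskerLeft A).hom_ext h₁ h₂

theorem comp_whiskerRight {A B D : C} {f g h : A ⟶ B} (η : I.TwoCell f g) (γ : I.TwoCell g h)
    (k : B ⟶ D) :
    (η.comp γ).whiskerRight k = (η.whiskerRight k).comp (γ.whiskerRight k) := by
  ext
  simp only [whiskerRight_hom, comp_hom, Category.assoc]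
  congr 1
  apply pair_ext <;> simp

theorem comp_whiskerLeft {A B D : C} (k : A ⟶ B) {f g h : B ⟶ D} (η : I.TwoCell f g)
    (γ : I.TwoCell g h) :
    whiskerLeft k (η.comp γ) = (whiskerLeft k η).comp (whiskerLeft k γ) := by
  ext
  simp only [whiskerLeft_hom, comp_hom]
  rw [← whisker_exchange_assoc]
  congr 1
  apply pair_ext
  · rw [whisker_exchange_assoc]; simp
  · rw [whisker_exchange_assoc]; simp

/-- Vertical composition expressed by the glueing of paths. -/
theorem comp_hom_of_glue {A Z : C} {D : C} {f g h : A ⟶ Z} (η : I.TwoCell f g)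
    (γ : I.TwoCell g h) (t : A ⊗ D ⟶ Z) (a b : X ⟶ D) (w : I.top ≫ a = I.bot ≫ b)
    (ha : A ◁ a ≫ t = η.hom) (hb : A ◁ b ≫ t = γ.hom) :
    (η.comp γ).hom = A ◁ (I.star ≫ I.glue a b w) ≫ t := by
  rw [comp_hom, MonoidalCategory.whiskerLeft_comp, Category.assoc]
  congr 1
  apply pair_ext
  · rw [down_pair, ← whiskerLeft_comp_assoc, I.down_glue, ha]
  · rw [up_pair, ← whiskerLeft_comp_assoc, I.up_glue, hb]

variable [HasPushouts C]

theorem isInvertible_iff {A B : C} {f g : A ⟶ B} (η : I.TwoCell f g) :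
    η.IsInvertible ↔ ∃ γ : I.TwoCell g f, η.comp γ = TwoCell.id f ∧ γ.comp η = TwoCell.id g :=
  ⟨fun h => h.out, fun h => ⟨h⟩⟩

theorem inverse_unique {A B : C} {f g : A ⟶ B} {η : I.TwoCell f g} {γ γ' : I.TwoCell g f}
    (h : γ.comp η = TwoCell.id g) (h' : η.comp γ' = TwoCell.id f) : γ = γ' := by
  rw [← γ.comp_id, ← h', ← TwoCell.assoc, h, TwoCell.id_comp]

theorem IsInvertible.whiskerLeft {A B D : C} {f g : A ⟶ B} {η : I.TwoCell f g}
    (h : η.IsInvertible) (k : D ⟶ A) : (TwoCell.whiskerLeft k η).IsInvertible := by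
  obtain ⟨γ, h₁, h₂⟩ := (isInvertible_iff _).1 h
  exact (isInvertible_iff _).2 ⟨TwoCell.whiskerLeft k γ,
    by rw [← comp_whiskerLeft, h₁, whiskerLeft_id],
    by rw [← comp_whiskerLeft, h₂, whiskerLeft_id]⟩

end TwoCell

variable [MonoidalClosed C]

section Functors

variable [HasPushouts C]

/-- Postcomposition as a functor between hom-categories. -/
def postcomp (A : C) {B D : C} (k : B ⟶ D) : I.HomCat A B ⥤ I.HomCat A D where
  obj f := (f : A ⟶ B) ≫ k
  map η := TwoCell.whiskerRight η k
  map_id _ := TwoCell.id_whiskerRight _ _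
  map_comp _ _ := TwoCell.comp_whiskerRight _ _ _

end Functors

/-! ### Squares -/

variable {I}

/-- Through the cotensor `P`, both squares become maps `A ⊗ X ⟶ P`. The faces in the inner cylinder
variable give their endpoints, by uniqueness in `one_dim`; those in the outer variable give their
projections to `Z`, by which a 2-cell into `P` is determined in `two_dim`. -/
theorem Representable.square_ext (hI : I.Representable) {A Z : C} {m m' : (A ⊗ X) ⊗ X ⟶ Z}
    (hb : I.botFace (A ⊗ X) ≫ m = I.botFace (A ⊗ X) ≫ m')
    (ht : I.topFace (A ⊗ X) ≫ m = I.topFace (A ⊗ X) ≫ m')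
    (hb' : I.botFace A ▷ X ≫ m = I.botFace A ▷ X ≫ m')
    (ht' : I.topFace A ▷ X ≫ m = I.topFace A ▷ X ≫ m') : m = m' := by
  obtain ⟨P, p₀, p₁, l, hl⟩ := hI.cotensor Z
  obtain ⟨t, rfl, -⟩ := hl.one_dim (TwoCell.mk' I m rfl rfl)
  obtain ⟨t', rfl, -⟩ := hl.one_dim (TwoCell.mk' I m' rfl rfl)
  rw [reassoc_of% botFace_naturality, reassoc_of% botFace_naturality, l.botFace_hom] at hb
  rw [reassoc_of% topFace_naturality, reassoc_of% topFace_naturality, l.topFace_hom] at ht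
  simp only [← comp_whiskerRight_assoc] at hb' ht'
  have hinj : ∀ {B : C} {s s' : B ⟶ P}, s ▷ X ≫ l.hom = s' ▷ X ≫ l.hom → s = s' := by
    intro B s s' h
    exact (hl.one_dim (TwoCell.mk' I (s' ▷ X ≫ l.hom) rfl rfl)).unique h rfl
  have eb := hinj hb'
  have et := hinj ht'
  congr 2
  let θ : I.TwoCell (I.botFace A ≫ t) (I.topFace A ≫ t) := TwoCell.mk' I t rfl rfl
  let θ' : I.TwoCell (I.botFace A ≫ t) (I.topFace A ≫ t) := TwoCell.mk' I t' eb.symm et.symm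
  have := (hl.two_dim (θ.whiskerRight p₀) (θ.whiskerRight p₁) (hI.interchange θ l).symm).unique
    (y₁ := θ) (y₂ := θ') ⟨rfl, rfl⟩ ⟨TwoCell.ext hb.symm, TwoCell.ext ht.symm⟩
  exact congrArg TwoCell.hom this

/-- `φ` and `ψ` are named by arrows `h, k : A ⟶ P`, and the commuting square is exactly the datum
from which `two_dim` yields a 2-cell from `h` to `k`. -/
theorem Representable.square_exists (hI : I.Representable) {A Z : C} {a b c d : A ⟶ Z}
    (φ : I.TwoCell a b) (ψ : I.TwoCell c d) (γ : I.TwoCell a c) (δ : I.TwoCell b d)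
    (w : γ.comp ψ = φ.comp δ) : ∃ m : (A ⊗ X) ⊗ X ⟶ Z,
      I.botFace (A ⊗ X) ≫ m = γ.hom ∧ I.topFace (A ⊗ X) ≫ m = δ.hom ∧
      I.botFace A ▷ X ≫ m = φ.hom ∧ I.topFace A ▷ X ≫ m = ψ.hom := by
  obtain ⟨P, p₀, p₁, l, hl⟩ := hI.cotensor Z
  obtain ⟨h, hh, -⟩ := hl.one_dim φ
  obtain ⟨k, hk, -⟩ := hl.one_dim ψ
  have e1 : h ≫ p₀ = a := by
    rw [← l.botFace_hom, ← reassoc_of% botFace_naturality, hh, φ.botFace_hom]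
  have e2 : h ≫ p₁ = b := by
    rw [← l.topFace_hom, ← reassoc_of% topFace_naturality, hh, φ.topFace_hom]
  have e3 : k ≫ p₀ = c := by
    rw [← l.botFace_hom, ← reassoc_of% botFace_naturality, hk, ψ.botFace_hom]
  have e4 : k ≫ p₁ = d := by
    rw [← l.topFace_hom, ← reassoc_of% topFace_naturality, hk, ψ.topFace_hom]
  subst e1 e2 e3 e4
  obtain rfl : TwoCell.whiskerLeft h l = φ := TwoCell.ext hh
  obtain rfl : TwoCell.whiskerLeft k l = ψ := TwoCell.ext hk
  obtain ⟨θ, ⟨rfl, rfl⟩, -⟩ := hl.two_dim γ δ w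
  refine ⟨θ.hom ▷ X ≫ l.hom, ?_, ?_, ?_, ?_⟩
  · rw [reassoc_of% botFace_naturality, l.botFace_hom]; rfl
  · rw [reassoc_of% topFace_naturality, l.topFace_hom]; rfl
  · rw [← comp_whiskerRight_assoc, θ.botFace_hom]; rfl
  · rw [← comp_whiskerRight_assoc, θ.topFace_hom]; rfl

/-- The analogue of "a natural transformation is invertible if its components are", with the two
ends of the cylinder as the objects. -/
theorem Representable.isInvertible_of_faces [HasPushouts C] (hI : I.Representable) {A Z : C}
    {h k : A ⊗ X ⟶ Z} (γ : I.TwoCell h k)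
    (hb : (TwoCell.whiskerLeft (I.botFace A) γ).IsInvertible)
    (ht : (TwoCell.whiskerLeft (I.topFace A) γ).IsInvertible) : γ.IsInvertible := by
  obtain ⟨u, hu, hu'⟩ := (TwoCell.isInvertible_iff _).1 hb
  obtain ⟨v, hv, hv'⟩ := (TwoCell.isInvertible_iff _).1 ht
  -- This is the naturality square of `γ` along the cylinder. Replacing its two sides coming from
  -- `γ` by their inverses `u` and `v` gives the square `w'`, whose filler is the inverse of `γ`.
  have w := hI.interchange (TwoCell.generic I A) γ
  have w' : ((TwoCell.generic I A).whiskerRight k).comp v =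
      u.comp ((TwoCell.generic I A).whiskerRight h) := by
    rw [← TwoCell.id_comp (((TwoCell.generic I A).whiskerRight k).comp v), ← hu', TwoCell.assoc,
      ← TwoCell.assoc _ _ v, w, TwoCell.assoc, hv, TwoCell.comp_id]
  obtain ⟨m, m1, m2, m3, m4⟩ := hI.square_exists _ _ _ _ w'
  simp only [TwoCell.whiskerRight_hom, TwoCell.generic_hom, Category.id_comp] at m1 m2
  let n : I.TwoCell k h := TwoCell.mk' I m m1 m2
  have nb : TwoCell.whiskerLeft (I.botFace A) n = u := TwoCell.ext m3
  have nt : TwoCell.whiskerLeft (I.topFace A) n = v := TwoCell.ext m4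
  have ext2 : ∀ {f g : A ⊗ X ⟶ Z} (x y : I.TwoCell f g),
      TwoCell.whiskerLeft (I.botFace A) x = TwoCell.whiskerLeft (I.botFace A) y →
      TwoCell.whiskerLeft (I.topFace A) x = TwoCell.whiskerLeft (I.topFace A) y → x = y := by
    intro f g x y h1 h2
    ext
    exact hI.square_ext (by rw [x.botFace_hom, y.botFace_hom])
      (by rw [x.topFace_hom, y.topFace_hom]) (congrArg TwoCell.hom h1) (congrArg TwoCell.hom h2)
  refine (TwoCell.isInvertible_iff _).2 ⟨n, ext2 _ _ ?_ ?_, ext2 _ _ ?_ ?_⟩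
  · rw [TwoCell.comp_whiskerLeft, TwoCell.whiskerLeft_id, nb, hu]
  · rw [TwoCell.comp_whiskerLeft, TwoCell.whiskerLeft_id, nt, hv]
  · rw [TwoCell.comp_whiskerLeft, TwoCell.whiskerLeft_id, nb, hu']
  · rw [TwoCell.comp_whiskerLeft, TwoCell.whiskerLeft_id, nt, hv']

end Monoidal

end Cocategory

end StrictInterval

end

noncomputable section

namespace StrictInterval

namespace Cocategory

/-! ### Inverses of composite paths -/

section Paths

variable {C : Type u} [Category.{v} C] {C₀ C₁ : C} (P : Cocategory C₀ C₁)

/-- The inner pair `b`, `b'` cancels, then `a`, `a'`. It provides the relations needed for `⋆` to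
descend to `J`. -/
theorem star_glue_inverse [HasPushouts C] {Z : C} {a a' b b' : C₁ ⟶ Z} (wab : P.top ≫ a = P.bot ≫ b)
    (wba : P.top ≫ b' = P.bot ≫ a') (wa : P.top ≫ a = P.bot ≫ a') (wb : P.top ≫ b = P.bot ≫ b')
    (ha : P.star ≫ P.glue a a' wa = P.coid ≫ P.bot ≫ a)
    (hb : P.star ≫ P.glue b b' wb = P.coid ≫ P.bot ≫ b) :
    P.star ≫ P.glue (P.star ≫ P.glue a b wab) (P.star ≫ P.glue b' a' wba)
        (by rw [top_star_glue, bot_star_glue, wb]) = P.coid ≫ P.bot ≫ a := by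
  have e : P.bot ≫ b = P.bot ≫ a' := by rw [← wab, wa]
  have h : P.star ≫ P.glue b (P.star ≫ P.glue b' a' wba) (by rw [bot_star_glue, wb]) = a' := by
    rw [star_glue_assoc _ _ _ _ wb]
    have hb' : P.star ≫ P.glue b b' wb = P.coid ≫ P.bot ≫ a' := by rw [hb, e]
    rw [P.glue_congr _ hb' rfl, star_glue_id_left]
  rw [← star_glue_assoc _ _ _ _ wab (by rw [bot_star_glue, wb]), P.glue_congr _ rfl h, ha]

end Paths

/-! ### Paths as 2-cells out of the unit, and 2-cells as paths in the internal hom -/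

section Interval

variable {C : Type u} [Category.{v} C] [MonoidalCategory C] {X Y : C} {I : Interval X}
  {J : Interval Y}

theorem _root_.StrictInterval.IsIntervalHom.star_glue {f : X ⟶ Y} (h : IsIntervalHom I J f) {Z : C}
    (a b : Y ⟶ Z) (w : J.top ≫ a = J.bot ≫ b) :
    f ≫ J.star ≫ J.glue a b w = I.star ≫ I.glue (f ≫ a) (f ≫ b) (by
      rw [← Category.assoc, h.top, w, ← h.bot, Category.assoc]) := by
  rw [← Category.assoc, h.star, Category.assoc, glue_comp]
  congr 1
  apply I.glue_congr <;> simp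

/-- A map out of the object of coarrows as a 2-cell between points. -/
def path (I : Interval X) {Z : C} {a b : 𝟙_ C ⟶ Z} (t : X ⟶ Z) (ha : I.bot ≫ t = a)
    (hb : I.top ≫ t = b) : I.TwoCell a b :=
  TwoCell.mk' I ((λ_ X).hom ≫ t) (by simp [botFace, ha, ← unitors_inv_equal])
    (by simp [topFace, hb, ← unitors_inv_equal])

@[simp]
theorem path_hom {Z : C} {a b : 𝟙_ C ⟶ Z} (t : X ⟶ Z) (ha : I.bot ≫ t = a)
    (hb : I.top ≫ t = b) : (I.path t ha hb).hom = (λ_ X).hom ≫ t := rfl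

/-- Currying turns vertical composition of 2-cells into concatenation of paths in the internal hom,
so that maps out of `J` can be built from 2-cells with any domain `A`. -/
theorem curry_star_glue [MonoidalClosed C] {A Z : C} {f g h : A ⟶ Z} (η : I.TwoCell f g) (γ : I.TwoCell g h)
    (w : I.top ≫ MonoidalClosed.curry η.hom = I.bot ≫ MonoidalClosed.curry γ.hom) :
    I.star ≫ I.glue (MonoidalClosed.curry η.hom) (MonoidalClosed.curry γ.hom) w =
      MonoidalClosed.curry (η.comp γ).hom := by
  rw [TwoCell.comp_hom, MonoidalClosed.curry_natural_left]
  congr 1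
  apply I.glue_ext
  · rw [I.down_glue, ← MonoidalClosed.curry_natural_left, TwoCell.down_pair]
  · rw [I.up_glue, ← MonoidalClosed.curry_natural_left, TwoCell.up_pair]

end Interval

/-! ### Maps out of `K` and `J` -/

section Free

variable {C : Type u} [Category.{v} C] [MonoidalCategory C] [HasFiniteColimits C] {X : C}
  (I : Interval X)

theorem kObj_ext {Z : C} {f g : I.kObj ⟶ Z} (h₁ : I.kInl ≫ f = I.kInl ≫ g)
    (h₂ : I.kInr ≫ f = I.kInr ≫ g) : f = g :=
  pushout.hom_ext h₁ h₂

theorem kDown_kGlue {Z : C} (h k : I.kObj ⟶ Z) (w : I.kTop ≫ h = I.kBot ≫ k) :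
    I.kDown ≫ I.kGlue h k w = h :=
  pushout.inl_desc _ _ _

theorem kUp_kGlue {Z : C} (h k : I.kObj ⟶ Z) (w : I.kTop ≫ h = I.kBot ≫ k) :
    I.kUp ≫ I.kGlue h k w = k :=
  pushout.inr_desc _ _ _

theorem kInl_kStar_kGlue {Z : C} (h k : I.kObj ⟶ Z) (w : I.kTop ≫ h = I.kBot ≫ k) :
    I.kInl ≫ I.kStar ≫ I.kGlue h k w = I.star ≫ I.glue (I.kInl ≫ h) (I.kInl ≫ k)
      (by simpa only [kTop, kBot, Category.assoc] using w) := by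
  rw [kStar, ← Category.assoc, kInl_kDesc, Category.assoc, glue_comp]
  congr 1
  apply I.glue_congr <;> simp [kDown_kGlue, kUp_kGlue]

theorem kInr_kStar_kGlue {Z : C} (h k : I.kObj ⟶ Z) (w : I.kTop ≫ h = I.kBot ≫ k) :
    I.kInr ≫ I.kStar ≫ I.kGlue h k w = I.star ≫ I.glue (I.kInr ≫ k) (I.kInr ≫ h)
      (by simpa only [kTop, kBot, bot_kInl, top_kInl, Category.assoc] using w.symm) := by
  rw [kStar, ← Category.assoc, kInr_kDesc, Category.assoc, glue_comp]
  congr 1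
  apply I.glue_congr <;> simp [kDown_kGlue, kUp_kGlue]

theorem kInl_kSymm : I.kInl ≫ I.kSymm = I.kInr := I.kInl_kDesc _ _ _ _

theorem kInr_kSymm : I.kInr ≫ I.kSymm = I.kInl := I.kInr_kDesc _ _ _ _

theorem kInl_kCoid : I.kInl ≫ I.kCoid = I.coid := I.kInl_kDesc _ _ _ _

theorem kInr_kCoid : I.kInr ≫ I.kCoid = I.coid := I.kInr_kDesc _ _ _ _

/-- The second copy of `I` in the free invertible interval, inverse to the first one. -/
def freeInv : X ⟶ I.freeObj := I.kInr ≫ I.freeQuot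

theorem bot_freeIncl : I.bot ≫ I.freeIncl = I.top ≫ I.freeInv := by
  rw [freeIncl, freeInv, ← Category.assoc, bot_kInl, Category.assoc]

theorem top_freeIncl : I.top ≫ I.freeIncl = I.bot ≫ I.freeInv := by
  rw [freeIncl, freeInv, ← Category.assoc, top_kInl, Category.assoc]

theorem freeQuot_condition :
    coprod.desc
      (I.kStar ≫ I.kGlue I.kSymm (𝟙 _) (by rw [kTop_kSymm, Category.comp_id]))
      (I.kStar ≫ I.kGlue (𝟙 _) I.kSymm (by rw [kBot_kSymm, Category.comp_id])) ≫ I.freeQuot =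
    coprod.desc (I.kCoid ≫ I.kTop) (I.kCoid ≫ I.kBot) ≫ I.freeQuot :=
  coequalizer.condition _ _

theorem star_glue_freeIncl_freeInv :
    I.star ≫ I.glue I.freeIncl I.freeInv I.top_freeIncl = I.coid ≫ I.bot ≫ I.freeIncl := by
  have h := congrArg (I.kInl ≫ coprod.inr ≫ ·) I.freeQuot_condition
  simp only [coprod.inr_desc_assoc, Category.assoc] at h
  rw [reassoc_of% kInl_kCoid, reassoc_of% kInl_kStar_kGlue, glue_comp] at h
  have h' : I.coid ≫ I.bot ≫ I.freeIncl = I.coid ≫ I.kBot ≫ I.freeQuot := by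
    rw [kBot, freeIncl, Category.assoc]
  refine Eq.trans ?_ (h.trans h'.symm)
  congr 1
  apply I.glue_congr
  · rw [Category.comp_id, freeIncl]
  · rw [kInl_kSymm, freeInv]

theorem star_glue_freeInv_freeIncl :
    I.star ≫ I.glue I.freeInv I.freeIncl I.bot_freeIncl.symm = I.coid ≫ I.top ≫ I.freeIncl := by
  have h := congrArg (I.kInl ≫ coprod.inl ≫ ·) I.freeQuot_condition
  simp only [coprod.inl_desc_assoc, Category.assoc] at h
  rw [reassoc_of% kInl_kCoid, reassoc_of% kInl_kStar_kGlue, glue_comp] at h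
  have h' : I.coid ≫ I.top ≫ I.freeIncl = I.coid ≫ I.kTop ≫ I.freeQuot := by
    rw [kTop, freeIncl, Category.assoc]
  refine Eq.trans ?_ (h.trans h'.symm)
  congr 1
  apply I.glue_congr
  · rw [kInl_kSymm, freeInv]
  · rw [Category.comp_id, freeIncl]

theorem kBot_kDesc {Z : C} (f g : X ⟶ Z) (hb : I.bot ≫ f = I.top ≫ g)
    (ht : I.top ≫ f = I.bot ≫ g) : I.kBot ≫ I.kDesc f g hb ht = I.bot ≫ f := by
  rw [kBot, Category.assoc, kInl_kDesc]

theorem kTop_kDesc {Z : C} (f g : X ⟶ Z) (hb : I.bot ≫ f = I.top ≫ g)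
    (ht : I.top ≫ f = I.bot ≫ g) : I.kTop ≫ I.kDesc f g hb ht = I.top ≫ f := by
  rw [kTop, Category.assoc, kInl_kDesc]

/-- The map out of the free invertible interval given by a pair of mutually inverse paths. -/
def freeDesc {Z : C} (f g : X ⟶ Z) (hb : I.bot ≫ f = I.top ≫ g) (ht : I.top ≫ f = I.bot ≫ g)
    (h₁ : I.star ≫ I.glue f g ht = I.coid ≫ I.bot ≫ f)
    (h₂ : I.star ≫ I.glue g f hb.symm = I.coid ≫ I.top ≫ f) : I.freeObj ⟶ Z :=
  coequalizer.desc (I.kDesc f g hb ht) (by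
    -- Because `⋆` is reversed on the second copy, each of the two relations restricts to the same
    -- equation on both copies of `I`; hence `h₁` and `h₂` settle all four cases.
    apply coprod.hom_ext
    · simp only [coprod.inl_desc_assoc, Category.assoc]
      apply I.kObj_ext
      · rw [reassoc_of% kInl_kStar_kGlue, glue_comp, reassoc_of% kInl_kCoid, kTop_kDesc, ← h₂]
        congr 1
        apply I.glue_congr <;> simp [kInl_kSymm]
      · rw [reassoc_of% kInr_kStar_kGlue, glue_comp, reassoc_of% kInr_kCoid, kTop_kDesc, ← h₂]
        congr 1
        apply I.glue_congr <;> simp [kInr_kSymm]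
    · simp only [coprod.inr_desc_assoc, Category.assoc]
      apply I.kObj_ext
      · rw [reassoc_of% kInl_kStar_kGlue, glue_comp, reassoc_of% kInl_kCoid, kBot_kDesc, ← h₁]
        congr 1
        apply I.glue_congr <;> simp [kInl_kSymm]
      · rw [reassoc_of% kInr_kStar_kGlue, glue_comp, reassoc_of% kInr_kCoid, kBot_kDesc, ← h₁]
        congr 1
        apply I.glue_congr <;> simp [kInr_kSymm])

section Desc

variable {Z : C} (f g : X ⟶ Z) (hb : I.bot ≫ f = I.top ≫ g) (ht : I.top ≫ f = I.bot ≫ g)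
    (h₁ : I.star ≫ I.glue f g ht = I.coid ≫ I.bot ≫ f)
    (h₂ : I.star ≫ I.glue g f hb.symm = I.coid ≫ I.top ≫ f)

@[simp]
theorem freeQuot_freeDesc : I.freeQuot ≫ I.freeDesc f g hb ht h₁ h₂ = I.kDesc f g hb ht :=
  coequalizer.π_desc _ _

@[simp]
theorem freeIncl_freeDesc : I.freeIncl ≫ I.freeDesc f g hb ht h₁ h₂ = f := by
  simp [freeIncl]

@[simp]
theorem freeInv_freeDesc : I.freeInv ≫ I.freeDesc f g hb ht h₁ h₂ = g := by
  simp [freeInv]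

end Desc

theorem free_ext {Z : C} {e e' : I.freeObj ⟶ Z} (h₁ : I.freeIncl ≫ e = I.freeIncl ≫ e')
    (h₂ : I.freeInv ≫ e = I.freeInv ≫ e') : e = e' := by
  apply coequalizer.hom_ext
  apply I.kObj_ext
  · rw [freeIncl, Category.assoc, Category.assoc] at h₁
    exact h₁
  · rw [freeInv, Category.assoc, Category.assoc] at h₂
    exact h₂

/-! ### The interval structure of the free invertible interval -/

/-- The coidentity map of the free invertible interval. -/
def freeCoid : I.freeObj ⟶ 𝟙_ C :=
  I.freeDesc I.coid I.coid (by rw [I.bot_coid, I.top_coid]) (by rw [I.bot_coid, I.top_coid])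
    (by
      -- The path `coid` in the unit is constant, so the equation is a unit law.
      have h := I.star_glue_id_left I.coid (by rw [I.bot_coid, Category.comp_id, I.top_coid])
      have e : I.coid ≫ I.bot ≫ I.coid = I.coid := by rw [I.bot_coid, Category.comp_id]
      rw [I.glue_congr _ e rfl] at h
      rw [h, e])
    (by
      have h := I.star_glue_id_left I.coid (by rw [I.bot_coid, Category.comp_id, I.top_coid])
      have e : I.coid ≫ I.bot ≫ I.coid = I.coid := by rw [I.bot_coid, Category.comp_id]
      rw [I.glue_congr _ e rfl] at h
      rw [h, I.top_coid, Category.comp_id])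

theorem freeIncl_freeCoid : I.freeIncl ≫ I.freeCoid = I.coid := I.freeIncl_freeDesc _ _ _ _ _ _

/-- The symmetry of the free invertible interval. -/
def freeSymm : I.freeObj ⟶ I.freeObj :=
  I.freeDesc I.freeInv I.freeIncl I.top_freeIncl.symm I.bot_freeIncl.symm
    (by rw [star_glue_freeInv_freeIncl, top_freeIncl])
    (by rw [star_glue_freeIncl_freeInv, bot_freeIncl])

theorem freeIncl_freeSymm : I.freeIncl ≫ I.freeSymm = I.freeInv := I.freeIncl_freeDesc _ _ _ _ _ _

/-- The object of cocomposable coarrows of the free invertible interval. -/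
def freeObj₂ : C := pushout (I.top ≫ I.freeIncl) (I.bot ≫ I.freeIncl)

def freeDown : I.freeObj ⟶ I.freeObj₂ := pushout.inl _ _

def freeUp : I.freeObj ⟶ I.freeObj₂ := pushout.inr _ _

theorem top_freeDown : I.top ≫ I.freeIncl ≫ I.freeDown = I.bot ≫ I.freeIncl ≫ I.freeUp := by
  rw [← Category.assoc, ← Category.assoc]
  exact pushout.condition

theorem top_freeUp : I.top ≫ I.freeInv ≫ I.freeUp = I.bot ≫ I.freeInv ≫ I.freeDown := by
  rw [← Category.assoc, ← Category.assoc, ← bot_freeIncl, ← top_freeIncl, Category.assoc,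
    Category.assoc, top_freeDown]

variable {I} in
theorem freeIncl_comp_inverse {Z : C} (e : I.freeObj ⟶ Z) :
    I.star ≫ I.glue (I.freeIncl ≫ e) (I.freeInv ≫ e)
      (by rw [← Category.assoc, top_freeIncl, Category.assoc]) = I.coid ≫ I.bot ≫ I.freeIncl ≫ e := by
  rw [← I.glue_comp _ _ I.top_freeIncl, reassoc_of% star_glue_freeIncl_freeInv]

variable {I} in
theorem freeInv_comp_inverse {Z : C} (e : I.freeObj ⟶ Z) :
    I.star ≫ I.glue (I.freeInv ≫ e) (I.freeIncl ≫ e)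
      (by rw [← Category.assoc, ← bot_freeIncl, Category.assoc]) =
        I.coid ≫ I.bot ≫ I.freeInv ≫ e := by
  rw [← I.glue_comp _ _ I.bot_freeIncl.symm, reassoc_of% star_glue_freeInv_freeIncl,
    reassoc_of% top_freeIncl]

/-- The cocomposition map of the free invertible interval. -/
def freeStar : I.freeObj ⟶ I.freeObj₂ :=
  I.freeDesc (I.star ≫ I.glue (I.freeIncl ≫ I.freeDown) (I.freeIncl ≫ I.freeUp) I.top_freeDown)
    (I.star ≫ I.glue (I.freeInv ≫ I.freeUp) (I.freeInv ≫ I.freeDown) I.top_freeUp)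
    (by rw [bot_star_glue, top_star_glue, reassoc_of% bot_freeIncl])
    (by rw [bot_star_glue, top_star_glue, reassoc_of% top_freeIncl])
    (by
      rw [I.star_glue_inverse _ _ _ _ (freeIncl_comp_inverse _) (freeIncl_comp_inverse _),
        bot_star_glue])
    (by
      rw [I.star_glue_inverse _ _ _ _ (freeInv_comp_inverse _) (freeInv_comp_inverse _),
        top_star_glue, reassoc_of% top_freeIncl])

theorem freeIncl_freeStar : I.freeIncl ≫ I.freeStar =
    I.star ≫ I.glue (I.freeIncl ≫ I.freeDown) (I.freeIncl ≫ I.freeUp) I.top_freeDown :=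
  I.freeIncl_freeDesc _ _ _ _ _ _

theorem freeInv_freeStar : I.freeInv ≫ I.freeStar =
    I.star ≫ I.glue (I.freeInv ≫ I.freeUp) (I.freeInv ≫ I.freeDown) I.top_freeUp :=
  I.freeInv_freeDesc _ _ _ _ _ _

/-- The structure maps of the free invertible interval, without the category axioms. -/
def freePre : PreCocategory (𝟙_ C) I.freeObj where
  C₂ := I.freeObj₂
  bot := I.bot ≫ I.freeIncl
  top := I.top ≫ I.freeIncl
  coid := I.freeCoid
  down := I.freeDown
  up := I.freeUp
  star := I.freeStar
  isPushout := IsPushout.of_hasPushout _ _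
  bot_coid := by rw [Category.assoc, freeIncl_freeCoid, I.bot_coid]
  top_coid := by rw [Category.assoc, freeIncl_freeCoid, I.top_coid]
  bot_star := by rw [Category.assoc, Category.assoc, freeIncl_freeStar, bot_star_glue]
  top_star := by rw [Category.assoc, Category.assoc, freeIncl_freeStar, top_star_glue]

theorem top_freePre_down :
    I.top ≫ I.freeIncl ≫ I.freePre.down = I.bot ≫ I.freeIncl ≫ I.freePre.up :=
  I.top_freeDown

theorem freeIncl_freePre_star : I.freeIncl ≫ I.freePre.star =
    I.star ≫ I.glue (I.freeIncl ≫ I.freePre.down) (I.freeIncl ≫ I.freePre.up) I.top_freePre_down :=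
  I.freeIncl_freeStar

theorem freeIncl_freePre_bot {Z : C} (t : I.freeObj ⟶ Z) :
    I.freePre.bot ≫ t = I.bot ≫ I.freeIncl ≫ t :=
  Category.assoc _ _ _

theorem freeIncl_freePre_top {Z : C} (t : I.freeObj ⟶ Z) :
    I.freePre.top ≫ t = I.top ≫ I.freeIncl ≫ t :=
  Category.assoc _ _ _

theorem freeIncl_freePre_coid {Z : C} (t : 𝟙_ C ⟶ Z) :
    I.freeIncl ≫ I.freePre.coid ≫ t = I.coid ≫ t :=
  by rw [← I.freeIncl_freeCoid, Category.assoc]; rfl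

theorem freeIncl_freePre_star_glue {Z : C} (a b : I.freeObj ⟶ Z)
    (w : I.freePre.top ≫ a = I.freePre.bot ≫ b) :
    I.freeIncl ≫ I.freePre.star ≫ I.freePre.glue a b w =
      I.star ≫ I.glue (I.freeIncl ≫ a) (I.freeIncl ≫ b)
        (by rwa [freeIncl_freePre_top, freeIncl_freePre_bot] at w) := by
  rw [reassoc_of% freeIncl_freePre_star, glue_comp]
  congr 1
  apply I.glue_congr
  · rw [Category.assoc, PreCocategory.down_glue]
  · rw [Category.assoc, PreCocategory.up_glue]

theorem freeQuot_freeSymm : I.freeQuot ≫ I.freeSymm = I.kSymm ≫ I.freeQuot := by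
  apply I.kObj_ext
  · have := I.freeIncl_freeSymm
    rw [freeIncl, Category.assoc] at this
    rw [this, reassoc_of% kInl_kSymm, freeInv]
  · have : I.freeInv ≫ I.freeSymm = I.freeIncl := I.freeInv_freeDesc _ _ _ _ _ _
    rw [freeInv, Category.assoc] at this
    rw [this, reassoc_of% kInr_kSymm, freeIncl]

/-! ### `J` classifies invertible 2-cells -/

section

variable {I}

/-- The 2-cell inverse to the one obtained by restricting `e` to the first copy of `I`. -/
theorem TwoCell.exists_freeInv {A Z : C} {f g : A ⟶ Z} (e : A ⊗ I.freeObj ⟶ Z)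
    (η : I.TwoCell f g) (hη : A ◁ I.freeIncl ≫ e = η.hom) :
    ∃ γ : I.TwoCell g f, A ◁ I.freeInv ≫ e = γ.hom := by
  refine ⟨TwoCell.mk' I (A ◁ I.freeInv ≫ e) ?_ ?_, rfl⟩
  · rw [← η.topFace_hom, ← hη]
    simp only [botFace, topFace, Category.assoc, ← whiskerLeft_comp_assoc, top_freeIncl]
  · rw [← η.botFace_hom, ← hη]
    simp only [botFace, topFace, Category.assoc, ← whiskerLeft_comp_assoc, bot_freeIncl]

end

variable [MonoidalClosed C]

theorem whiskerLeft_free_ext {A Z : C} {e e' : A ⊗ I.freeObj ⟶ Z}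
    (h₁ : A ◁ I.freeIncl ≫ e = A ◁ I.freeIncl ≫ e')
    (h₂ : A ◁ I.freeInv ≫ e = A ◁ I.freeInv ≫ e') : e = e' := by
  apply MonoidalClosed.curry_injective
  apply I.free_ext
  · rw [← MonoidalClosed.curry_natural_left, h₁, MonoidalClosed.curry_natural_left]
  · rw [← MonoidalClosed.curry_natural_left, h₂, MonoidalClosed.curry_natural_left]

variable {I}

/-- The relations imposed on `J`, tensored with `A` and followed by `e`. -/
theorem TwoCell.comp_freeInv {A Z : C} {f g : A ⟶ Z} (e : A ⊗ I.freeObj ⟶ Z)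
    (η : I.TwoCell f g) (γ : I.TwoCell g f) (hη : A ◁ I.freeIncl ≫ e = η.hom)
    (hγ : A ◁ I.freeInv ≫ e = γ.hom) : η.comp γ = TwoCell.id f ∧ γ.comp η = TwoCell.id g := by
  constructor
  · ext
    rw [η.comp_hom_of_glue γ e _ _ I.top_freeIncl hη hγ, star_glue_freeIncl_freeInv,
      MonoidalCategory.whiskerLeft_comp, MonoidalCategory.whiskerLeft_comp]
    simp [hη, η.bot_hom]
  · ext
    rw [γ.comp_hom_of_glue η e _ _ I.bot_freeIncl.symm hγ hη, star_glue_freeInv_freeIncl,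
      MonoidalCategory.whiskerLeft_comp, MonoidalCategory.whiskerLeft_comp]
    simp [hη, η.top_hom]

theorem TwoCell.isInvertible_of_free {A Z : C} {f g : A ⟶ Z} (e : A ⊗ I.freeObj ⟶ Z)
    (η : I.TwoCell f g) (hη : A ◁ I.freeIncl ≫ e = η.hom) : η.IsInvertible := by
  obtain ⟨γ, hγ⟩ := TwoCell.exists_freeInv e η hη
  exact (isInvertible_iff _).2 ⟨γ, comp_freeInv e η γ hη hγ⟩

/-- An extension to `A ⊗ J` consists of a 2-cell and an inverse to it, and inverses are unique. This
is what lets identities for `J` be verified on `I`. -/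
instance (A : C) : Epi (A ◁ I.freeIncl) where
  left_cancellation {Z} e e' h := by
    let η := TwoCell.mk' I (A ◁ I.freeIncl ≫ e) rfl rfl
    obtain ⟨γ, hγ⟩ := TwoCell.exists_freeInv e η rfl
    obtain ⟨γ', hγ'⟩ := TwoCell.exists_freeInv e' η h.symm
    have := TwoCell.inverse_unique (TwoCell.comp_freeInv e η γ rfl hγ).2
      (TwoCell.comp_freeInv e' η γ' h.symm hγ').1
    exact I.whiskerLeft_free_ext h (by rw [hγ, hγ', this])

/-- After currying, the 2-cell and its inverse are mutually inverse paths in the internal hom. -/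
theorem TwoCell.IsInvertible.exists_free {A Z : C} {f g : A ⟶ Z} {η : I.TwoCell f g}
    (h : η.IsInvertible) : ∃ e : A ⊗ I.freeObj ⟶ Z, A ◁ I.freeIncl ≫ e = η.hom := by
  obtain ⟨γ, h₁, h₂⟩ := (isInvertible_iff _).1 h
  refine ⟨MonoidalClosed.uncurry (I.freeDesc (MonoidalClosed.curry η.hom)
    (MonoidalClosed.curry γ.hom) ?_ ?_ ?_ ?_), ?_⟩
  · simp only [← MonoidalClosed.curry_natural_left, η.bot_hom, γ.top_hom]
  · simp only [← MonoidalClosed.curry_natural_left, η.top_hom, γ.bot_hom]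
  · rw [curry_star_glue, h₁]
    simp only [← MonoidalClosed.curry_natural_left, η.bot_hom, id_hom]
  · rw [curry_star_glue, h₂]
    simp only [← MonoidalClosed.curry_natural_left, η.top_hom, id_hom]
  · rw [← MonoidalClosed.uncurry_natural_left, freeIncl_freeDesc, MonoidalClosed.uncurry_curry]

theorem exists_free_of_path {Z : C} {a b : 𝟙_ C ⟶ Z} {t : X ⟶ Z} {ha : I.bot ≫ t = a}
    {hb : I.top ≫ t = b} (h : (I.path t ha hb).IsInvertible) :
    ∃ e : I.freeObj ⟶ Z, I.freeIncl ≫ e = t := by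
  obtain ⟨e, he⟩ := h.exists_free
  refine ⟨(λ_ _).inv ≫ e, ?_⟩
  rw [leftUnitor_inv_naturality_assoc, he, path_hom, Iso.inv_hom_id_assoc]

theorem path_isInvertible {Z : C} {a b : 𝟙_ C ⟶ Z} (e : I.freeObj ⟶ Z)
    (ha : I.bot ≫ I.freeIncl ≫ e = a) (hb : I.top ≫ I.freeIncl ≫ e = b) :
    (I.path (I.freeIncl ≫ e) ha hb).IsInvertible :=
  TwoCell.isInvertible_of_free ((λ_ _).hom ≫ e) _ (by simp)

instance : Epi I.freeIncl where
  left_cancellation {Z} e e' h := by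
    have : (λ_ _).hom ≫ e = (λ_ _).hom ≫ e' := by
      rw [← cancel_epi (𝟙_ C ◁ I.freeIncl)]
      simp [h]
    simpa using this

instance [BraidedCategory C] (A : C) : Epi (I.freeIncl ▷ A) where
  left_cancellation {Z} e e' h := by
    have : (β_ _ _).hom ≫ e = (β_ _ _).hom ≫ e' := by
      rw [← cancel_epi (A ◁ I.freeIncl)]
      simp [h]
    simpa using this

/-! ### The invertible interval `J` and its universal property -/

variable (I)

/-- The free invertible interval generated by `I`. -/
def free : Interval I.freeObj where
  toPreCocategory := I.freePre
  counit_left := by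
    rw [← cancel_epi I.freeIncl, freeIncl_freePre_star_glue]
    refine Eq.trans ?_ ((I.star_glue_id_left I.freeIncl
      (by rw [reassoc_of% I.top_coid])).trans (Category.comp_id _).symm)
    congr 1
    apply I.glue_congr
    · rw [freeIncl_freePre_coid]; rfl
    · rw [Category.comp_id]
  counit_right := by
    rw [← cancel_epi I.freeIncl, freeIncl_freePre_star_glue]
    refine Eq.trans ?_ ((I.star_glue_id_right I.freeIncl
      (by rw [reassoc_of% I.bot_coid])).trans (Category.comp_id _).symm)
    congr 1
    apply I.glue_congr
    · rw [Category.comp_id]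
    · rw [freeIncl_freePre_coid]; rfl
  coassoc := by
    intro C₃ d u h
    have e := h.w
    have w (t : I.freePre.C₂ ⟶ C₃) : I.top ≫ I.freeIncl ≫ I.freePre.down ≫ t =
        I.bot ≫ I.freeIncl ≫ I.freePre.up ≫ t := by
      rw [← freeIncl_freePre_top, ← freeIncl_freePre_bot, ← Category.assoc,
        I.freePre.isPushout.w, Category.assoc]
    have h1 (t : I.freePre.C₂ ⟶ C₃) : I.freeIncl ≫ I.freePre.star ≫ t =
        I.star ≫ I.glue (I.freeIncl ≫ I.freePre.down ≫ t)
        (I.freeIncl ≫ I.freePre.up ≫ t) (w t) := by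
      rw [reassoc_of% freeIncl_freePre_star, glue_comp]
      congr 1
      apply I.glue_congr <;> rw [Category.assoc]
    -- Restricted to `I`, coassociativity becomes associativity of concatenation for the three
    -- copies of `ι` in `C₃`.
    rw [← cancel_epi I.freeIncl, freeIncl_freePre_star_glue, freeIncl_freePre_star_glue,
      I.glue_congr _ rfl (h1 u), I.glue_congr _ (h1 d) rfl]
    refine Eq.trans ?_ (I.star_glue_assoc (I.freeIncl ≫ I.freePre.down ≫ d)
      (I.freeIncl ≫ I.freePre.up ≫ d) (I.freeIncl ≫ I.freePre.up ≫ u) (w d)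
      (by rw [e, w]))
    congr 1
    apply I.glue_congr _ rfl
    congr 1
    apply I.glue_congr _ _ rfl
    rw [e]

theorem freeIncl_isIntervalHom : IsIntervalHom I I.free I.freeIncl where
  bot := rfl
  top := rfl
  coid := I.freeIncl_freeCoid
  star := I.freeIncl_freeStar

theorem free_isQuotientStructure : I.IsQuotientStructure I.free where
  bot := Category.assoc _ _ _
  top := Category.assoc _ _ _
  coid := by
    change I.freeQuot ≫ I.freeCoid = _
    rw [freeCoid, freeQuot_freeDesc]
    rfl
  star := by
    apply I.kObj_ext
    · rw [kInl_kStar_kGlue]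
      have := I.freeIncl_freeStar
      simp only [freeIncl, Category.assoc] at this
      exact this
    · rw [kInr_kStar_kGlue]
      have := I.freeInv_freeStar
      simp only [freeInv, Category.assoc] at this
      exact this

theorem free_isSymmetry : I.free.IsSymmetry I.freeSymm where
  bot := by
    change (I.bot ≫ I.freeIncl) ≫ _ = I.top ≫ I.freeIncl
    rw [Category.assoc, freeIncl_freeSymm, top_freeIncl]
  top := by
    change (I.top ≫ I.freeIncl) ≫ _ = I.bot ≫ I.freeIncl
    rw [Category.assoc, freeIncl_freeSymm, bot_freeIncl]
  left := by
    rw [← cancel_epi I.freeIncl, I.freeIncl_isIntervalHom.star_glue,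
      reassoc_of% I.freeIncl_isIntervalHom.coid]
    refine Eq.trans ?_ I.star_glue_freeInv_freeIncl
    congr 1
    exact I.glue_congr _ I.freeIncl_freeSymm (Category.comp_id _)
  right := by
    rw [← cancel_epi I.freeIncl, I.freeIncl_isIntervalHom.star_glue,
      reassoc_of% I.freeIncl_isIntervalHom.coid]
    refine Eq.trans ?_ I.star_glue_freeIncl_freeInv
    congr 1
    exact I.glue_congr _ (Category.comp_id _) I.freeIncl_freeSymm

/-- The symmetry `s` of `H` makes `ξ ≫ s` an inverse path to `ξ`, which gives the extension.
Uniqueness and compatibility with the structure maps follow by cancelling the epimorphism `ι`. -/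
theorem free_universal {Y : C} (H : Interval Y) (hH : H.Invertible) (ξ : X ⟶ Y)
    (hξ : IsIntervalHom I H ξ) :
    ∃! ξ' : I.freeObj ⟶ Y, IsIntervalHom I.free H ξ' ∧ I.freeIncl ≫ ξ' = ξ := by
  obtain ⟨s, hs⟩ := hH
  have hbot := hξ.bot
  have htop := hξ.top
  obtain ⟨e, he⟩ : ∃ e : I.freeObj ⟶ Y, I.freeIncl ≫ e = ξ := by
    refine ⟨I.freeDesc ξ (ξ ≫ s) ?_ ?_ ?_ ?_, I.freeIncl_freeDesc _ _ _ _ _ _⟩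
    · rw [reassoc_of% htop, hbot, hs.top]
    · rw [reassoc_of% hbot, htop, hs.bot]
    · have h := ξ ≫= hs.right
      rw [hξ.star_glue, reassoc_of% hξ.coid] at h
      refine Eq.trans ?_ (h.trans (congrArg _ hbot.symm))
      congr 1
      exact I.glue_congr _ (Category.comp_id _).symm rfl
    · have h := ξ ≫= hs.left
      rw [hξ.star_glue, reassoc_of% hξ.coid] at h
      refine Eq.trans ?_ (h.trans (congrArg _ htop.symm))
      congr 1
      exact I.glue_congr _ rfl (Category.comp_id _).symm
  refine ⟨e, ⟨⟨?_, ?_, ?_, ?_⟩, he⟩, ?_⟩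
  · change (I.bot ≫ I.freeIncl) ≫ _ = _
    rw [Category.assoc, he, hbot]
  · change (I.top ≫ I.freeIncl) ≫ _ = _
    rw [Category.assoc, he, htop]
  · rw [← cancel_epi I.freeIncl, reassoc_of% he]
    exact hξ.coid.trans I.freeIncl_isIntervalHom.coid.symm
  · rw [← cancel_epi I.freeIncl, reassoc_of% he]
    refine hξ.star.trans (Eq.trans ?_ (I.freeIncl_isIntervalHom.star_glue _ _ _).symm)
    congr 1
    apply I.glue_congr <;> rw [reassoc_of% he]
  · rintro χ ⟨-, hχ⟩
    rw [← cancel_epi I.freeIncl, hχ, he]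

end Free

end Cocategory

end StrictInterval

end

noncomputable section

namespace StrictInterval

namespace Cocategory

/-! ### The comonoid structure of an interval -/

section Comul

variable {C : Type u} [Category.{v} C] [MonoidalCategory C] {X Y : C} (I : Interval X)

theorem bot_comul : I.bot ≫ I.comul = (λ_ _).inv ≫ (I.bot ⊗ₘ I.bot) := by
  rw [comul, bot_star_glue, leftUnitor_inv_naturality_assoc, MonoidalCategory.tensorHom_def']

theorem top_comul : I.top ≫ I.comul = (λ_ _).inv ≫ (I.top ⊗ₘ I.top) := by
  rw [comul, top_star_glue, rightUnitor_inv_naturality_assoc, MonoidalCategory.tensorHom_def,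
    unitors_inv_equal]

theorem comul_coid_whiskerRight : I.comul ≫ I.coid ▷ X = (λ_ X).inv := by
  rw [comul, Category.assoc, glue_comp]
  refine Eq.trans ?_ (I.star_glue_id_right (λ_ X).inv (by
    rw [reassoc_of% I.bot_coid]))
  congr 1
  apply I.glue_congr
  · simp [← comp_whiskerRight, I.bot_coid]
  · rw [Category.assoc, whisker_exchange, ← rightUnitor_inv_naturality_assoc,
      leftUnitor_inv_naturality, unitors_inv_equal]

theorem comul_coid_whiskerLeft : I.comul ≫ X ◁ I.coid = (ρ_ X).inv := by
  rw [comul, Category.assoc, glue_comp]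
  refine Eq.trans ?_ (I.star_glue_id_left (ρ_ X).inv (by
    rw [reassoc_of% I.top_coid]))
  congr 1
  apply I.glue_congr
  · rw [Category.assoc, ← whisker_exchange, ← leftUnitor_inv_naturality_assoc,
      rightUnitor_inv_naturality, unitors_inv_equal]
  · simp [← MonoidalCategory.whiskerLeft_comp, I.top_coid]

theorem comul_coid_tensor : I.comul ≫ (I.coid ⊗ₘ I.coid) = I.coid ≫ (λ_ _).inv := by
  rw [MonoidalCategory.tensorHom_def, ← Category.assoc, comul_coid_whiskerRight,
    leftUnitor_inv_naturality]

/-- Both sides are the path along three successive edges of the cube `X ⊗ X ⊗ X`, bracketed in the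
two possible ways. -/
theorem comul_coassoc [HasPushouts C] :
    I.comul ≫ X ◁ I.comul = I.comul ≫ I.comul ▷ X ≫ (α_ X X X).hom := by
  -- The edges are, in symbols, `a(t) = ⊥ ⊗ ⊥ ⊗ t`, `b(t) = ⊥ ⊗ t ⊗ ⊤` and `c(t) = t ⊗ ⊤ ⊗ ⊤`.
  let a : X ⟶ X ⊗ X ⊗ X := (λ_ X).inv ≫ I.bot ▷ X ≫ (λ_ _).inv ≫ I.bot ▷ (X ⊗ X)
  let b : X ⟶ X ⊗ X ⊗ X := (ρ_ X).inv ≫ X ◁ I.top ≫ (λ_ _).inv ≫ I.bot ▷ (X ⊗ X)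
  let c : X ⟶ X ⊗ X ⊗ X := (ρ_ X).inv ≫ X ◁ (I.top ≫ I.comul)
  have e₁ (t : X ⊗ X ⟶ X ⊗ X ⊗ X) (w) : I.comul ≫ t = I.star ≫ I.glue
      ((λ_ X).inv ≫ I.bot ▷ X ≫ t) ((ρ_ X).inv ≫ X ◁ I.top ≫ t) w := by
    rw [comul, Category.assoc, glue_comp]
    congr 1
    apply I.glue_congr <;> rw [Category.assoc]
  have w : I.top ≫ (λ_ X).inv ≫ I.bot ▷ X = I.bot ≫ (ρ_ X).inv ≫ X ◁ I.top := by
    rw [leftUnitor_inv_naturality_assoc, rightUnitor_inv_naturality_assoc, whisker_exchange,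
      unitors_inv_equal]
  have w' (t : X ⊗ X ⟶ X ⊗ X ⊗ X) :
      I.top ≫ (λ_ X).inv ≫ I.bot ▷ X ≫ t = I.bot ≫ (ρ_ X).inv ≫ X ◁ I.top ≫ t := by
    simpa only [Category.assoc] using w =≫ t
  have wab : I.top ≫ a = I.bot ≫ b := w' _
  have hunit : (λ_ _).inv ≫ I.bot ▷ (X ⊗ X) =
      (λ_ X).inv ▷ X ≫ I.bot ▷ X ▷ X ≫ (α_ X X X).hom := by
    rw [associator_naturality_left]
    simp
  have hl : (λ_ X).inv ≫ I.bot ▷ X ≫ X ◁ I.comul = I.star ≫ I.glue a b wab := by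
    rw [← whisker_exchange, ← leftUnitor_inv_naturality_assoc, e₁ _ (w' _)]
  have hc : (ρ_ X).inv ≫ X ◁ I.top ≫ X ◁ I.comul = c := by
    rw [← MonoidalCategory.whiskerLeft_comp]
  have ha : (λ_ X).inv ≫ I.bot ▷ X ≫ I.comul ▷ X ≫ (α_ X X X).hom = a := by
    rw [← comp_whiskerRight_assoc, bot_comul]
    simp only [a, MonoidalCategory.tensorHom_def', comp_whiskerRight, Category.assoc, hunit]
    rw [← comp_whiskerRight_assoc I.bot, leftUnitor_inv_naturality, comp_whiskerRight_assoc]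
  have hb : (λ_ X).inv ≫ I.bot ▷ X ≫ (ρ_ _).inv ≫ (X ⊗ X) ◁ I.top ≫ (α_ X X X).hom = b := by
    rw [rightUnitor_inv_naturality_assoc, rightUnitor_inv_naturality_assoc,
      ← whisker_exchange_assoc, ← whisker_exchange_assoc, ← hunit]
  have hc' : (ρ_ X).inv ≫ X ◁ I.top ≫ (ρ_ _).inv ≫ (X ⊗ X) ◁ I.top ≫ (α_ X X X).hom = c := by
    simp only [c, top_comul, MonoidalCategory.tensorHom_def, MonoidalCategory.whiskerLeft_comp]
    have ht : (λ_ _).inv ≫ I.top ▷ 𝟙_ C = I.top ≫ (ρ_ X).inv := by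
      rw [rightUnitor_inv_naturality, unitors_inv_equal]
    rw [associator_naturality_right, ← whiskerLeft_comp_assoc X (λ_ _).inv, ht]
    simp
  have wbc : I.top ≫ b = I.bot ≫ c := by
    rw [← hb, ← hc']
    exact w' _
  have hr : (ρ_ X).inv ≫ X ◁ I.top ≫ I.comul ▷ X ≫ (α_ X X X).hom =
      I.star ≫ I.glue b c wbc := by
    rw [whisker_exchange_assoc, ← rightUnitor_inv_naturality_assoc, e₁ _ (w' _)]
    congr 1
    exact I.glue_congr _ hb hc'
  rw [e₁ _ (w' _), e₁ _ (w' _), I.glue_congr _ hl hc, I.glue_congr _ ha hr]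
  exact (I.star_glue_assoc a b c wab wbc).symm

theorem _root_.StrictInterval.IsIntervalHom.comul {I : Interval X} {J : Interval Y} {f : X ⟶ Y}
    (h : IsIntervalHom I J f) : f ≫ J.comul = I.comul ≫ (f ⊗ₘ f) := by
  have e₁ : f ≫ (λ_ Y).inv ≫ J.bot ▷ Y = ((λ_ X).inv ≫ I.bot ▷ X) ≫ (f ⊗ₘ f) := by
    rw [leftUnitor_inv_naturality_assoc, Category.assoc, ← h.bot, MonoidalCategory.tensorHom_def,
      comp_whiskerRight, whisker_exchange_assoc, ← whisker_exchange f f]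
  have e₂ : f ≫ (ρ_ Y).inv ≫ Y ◁ J.top = ((ρ_ X).inv ≫ X ◁ I.top) ≫ (f ⊗ₘ f) := by
    rw [rightUnitor_inv_naturality_assoc, Category.assoc, ← h.top, MonoidalCategory.tensorHom_def',
      MonoidalCategory.whiskerLeft_comp, ← whisker_exchange_assoc, ← whisker_exchange f f]
  refine (h.star_glue _ _ _).trans (Eq.trans ?_ (Category.assoc _ _ _).symm)
  rw [glue_comp]
  congr 1
  exact I.glue_congr _ e₁ e₂

end Comul

/-! ### Meet operations -/

section Meet

variable {C : Type u} [Category.{v} C] [MonoidalCategory C] {X : C} (I : Interval X)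

/-- Maps out of `(A ⊗ X) ⊗ X` are determined by their restrictions to the four faces. -/
def IsSquareSeparated : Prop :=
  ∀ ⦃A Z : C⦄ ⦃m m' : (A ⊗ X) ⊗ X ⟶ Z⦄, (A ⊗ X) ◁ I.bot ≫ m = (A ⊗ X) ◁ I.bot ≫ m' →
    (A ⊗ X) ◁ I.top ≫ m = (A ⊗ X) ◁ I.top ≫ m' →
    (A ◁ I.bot) ▷ X ≫ m = (A ◁ I.bot) ▷ X ≫ m' →
    (A ◁ I.top) ▷ X ≫ m = (A ◁ I.top) ▷ X ≫ m' → m = m'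

variable {I}

theorem Representable.isSquareSeparated [MonoidalClosed C] (hI : I.Representable) :
    I.IsSquareSeparated := by
  intro A Z m m' h₁ h₂ h₃ h₄
  apply hI.square_ext
  · rw [botFace, Category.assoc, h₁, Category.assoc]
  · rw [topFace, Category.assoc, h₂, Category.assoc]
  · rw [botFace, comp_whiskerRight, Category.assoc, h₃, Category.assoc]
  · rw [topFace, comp_whiskerRight, Category.assoc, h₄, Category.assoc]

theorem IsSquareSeparated.ext (hI : I.IsSquareSeparated) {Z : C} {m m' : X ⊗ X ⟶ Z}
    (h₁ : X ◁ I.bot ≫ m = X ◁ I.bot ≫ m') (h₂ : X ◁ I.top ≫ m = X ◁ I.top ≫ m')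
    (h₃ : I.bot ▷ X ≫ m = I.bot ▷ X ≫ m') (h₄ : I.top ▷ X ≫ m = I.top ▷ X ≫ m') : m = m' := by
  have : (λ_ X).hom ▷ X ≫ m = (λ_ X).hom ▷ X ≫ m' := by
    apply hI
    · rw [whisker_exchange_assoc, h₁, whisker_exchange_assoc]
    · rw [whisker_exchange_assoc, h₂, whisker_exchange_assoc]
    · rw [← comp_whiskerRight_assoc, leftUnitor_naturality, comp_whiskerRight_assoc, h₃,
        ← comp_whiskerRight_assoc, ← leftUnitor_naturality, comp_whiskerRight_assoc]
    · rw [← comp_whiskerRight_assoc, leftUnitor_naturality, comp_whiskerRight_assoc, h₄,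
        ← comp_whiskerRight_assoc, ← leftUnitor_naturality, comp_whiskerRight_assoc]
  rwa [cancel_epi] at this

namespace IsMeet

variable {m m' : X ⊗ X ⟶ X}

theorem unique (hI : I.IsSquareSeparated) (hm : I.IsMeet m) (hm' : I.IsMeet m') : m = m' :=
  hI.ext (hm.bot_right.trans hm'.bot_right.symm) (hm.top_right.trans hm'.top_right.symm)
    (hm.bot_left.trans hm'.bot_left.symm) (hm.top_left.trans hm'.top_left.symm)

theorem mul_coid (hI : I.IsSquareSeparated) (hm : I.IsMeet m) :
    m ≫ I.coid = (I.coid ⊗ₘ I.coid) ≫ (λ_ _).hom := by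
  have hb : I.bot ≫ I.coid = 𝟙 _ := I.bot_coid
  have ht : I.top ≫ I.coid = 𝟙 _ := I.top_coid
  apply hI.ext
  · rw [reassoc_of% hm.bot_right, hb, MonoidalCategory.tensorHom_def', Category.assoc,
      ← whiskerLeft_comp_assoc, hb]
    simp [unitors_equal]
  · rw [reassoc_of% hm.top_right, MonoidalCategory.tensorHom_def', Category.assoc,
      ← whiskerLeft_comp_assoc, ht]
    simp [unitors_equal]
  · rw [reassoc_of% hm.bot_left, hb, MonoidalCategory.tensorHom_def, Category.assoc,
      ← comp_whiskerRight_assoc, hb]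
    simp
  · rw [reassoc_of% hm.top_left, MonoidalCategory.tensorHom_def, Category.assoc,
      ← comp_whiskerRight_assoc, ht]
    simp

/-- Only the faces in the last two variables are compared; the first variable is the parameter `A =
X` of square separation. -/
theorem assoc (hI : I.IsSquareSeparated) (hm : I.IsMeet m) :
    m ▷ X ≫ m = (α_ X X X).hom ≫ X ◁ m ≫ m := by
  have hc := hm.mul_coid hI
  apply hI
  · rw [whisker_exchange_assoc, hm.bot_right, associator_naturality_right_assoc,
      ← whiskerLeft_comp_assoc, hm.bot_right]
    simp only [rightUnitor_naturality_assoc, reassoc_of% hc, MonoidalCategory.whiskerLeft_comp,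
      Category.assoc, hm.bot_right, MonoidalCategory.tensorHom_def']
    simp [unitors_equal]
  · rw [whisker_exchange_assoc, hm.top_right, associator_naturality_right_assoc,
      ← whiskerLeft_comp_assoc, hm.top_right]
    simp
  · rw [← comp_whiskerRight_assoc, hm.bot_right, associator_naturality_middle_assoc,
      ← whiskerLeft_comp_assoc, hm.bot_left]
    simp only [comp_whiskerRight, MonoidalCategory.whiskerLeft_comp, Category.assoc, hm.bot_right,
      hm.bot_left]
    rw [triangle_assoc]
    congr 1
    rw [← leftUnitor_naturality_assoc, ← rightUnitor_naturality_assoc, whisker_exchange_assoc,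
      unitors_equal]
  · rw [← comp_whiskerRight_assoc, hm.top_right, associator_naturality_middle_assoc,
      ← whiskerLeft_comp_assoc, hm.top_left, triangle_assoc]

variable [SymmetricCategory C]

theorem comm (hI : I.IsSquareSeparated) (hm : I.IsMeet m) : (β_ X X).hom ≫ m = m := by
  refine unique hI ⟨?_, ?_, ?_, ?_⟩ hm
  · rw [BraidedCategory.braiding_naturality_right_assoc, hm.bot_left]
    simp
  · rw [BraidedCategory.braiding_naturality_right_assoc, hm.top_left]
    simp
  · rw [BraidedCategory.braiding_naturality_left_assoc, hm.bot_right]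
    simp
  · rw [BraidedCategory.braiding_naturality_left_assoc, hm.top_right]
    simp

/-- On each face one variable is an endpoint, which `Δ` sends to its tensor square, and `m` becomes
the identity or `⊥ ∘ i`, both of which commute with `Δ`. -/
theorem mul_comul (hI : I.IsSquareSeparated) (hm : I.IsMeet m) : m ≫ I.comul =
    (I.comul ⊗ₘ I.comul) ≫ tensorμ _ _ _ _ ≫ (m ⊗ₘ m) := by
  -- Here `x` is the endpoint put in the second variable and `y` the endomorphism that `m` becomes
  -- there; the remaining identity is a unit coherence of `tensorμ`. In `aux'` the endpoint is in
  -- the first variable.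
  have aux (x : 𝟙_ C ⟶ X) (y : X ⟶ X)
      (hx : x ≫ I.comul = (λ_ _).inv ≫ (x ⊗ₘ x))
      (hy : X ◁ x ≫ m = (ρ_ _).hom ≫ y)
      (hy' : y ≫ I.comul = I.comul ≫ (y ⊗ₘ y)) :
      X ◁ x ≫ m ≫ I.comul = X ◁ x ≫ (I.comul ⊗ₘ I.comul) ≫ tensorμ _ _ _ _ ≫ (m ⊗ₘ m) := by
    rw [reassoc_of% hy, hy', whiskerLeft_comp_tensorHom_assoc, hx,
      MonoidalCategory.tensorHom_def I.comul, MonoidalCategory.whiskerLeft_comp]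
    simp only [Category.assoc]
    rw [tensorμ_natural_right_assoc, tensorHom_comp_tensorHom, hy,
      ← tensorHom_comp_tensorHom, ← tensor_right_unitality_assoc, rightUnitor_naturality_assoc]
  have aux' (x : 𝟙_ C ⟶ X) (y : X ⟶ X)
      (hx : x ≫ I.comul = (λ_ _).inv ≫ (x ⊗ₘ x))
      (hy : x ▷ X ≫ m = (λ_ _).hom ≫ y)
      (hy' : y ≫ I.comul = I.comul ≫ (y ⊗ₘ y)) :
      x ▷ X ≫ m ≫ I.comul = x ▷ X ≫ (I.comul ⊗ₘ I.comul) ≫ tensorμ _ _ _ _ ≫ (m ⊗ₘ m) := by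
    rw [reassoc_of% hy, hy', whiskerRight_comp_tensorHom_assoc, hx,
      MonoidalCategory.tensorHom_def' _ I.comul, comp_whiskerRight]
    simp only [Category.assoc]
    rw [tensorμ_natural_left_assoc, tensorHom_comp_tensorHom, hy,
      ← tensorHom_comp_tensorHom, ← tensor_left_unitality_assoc, leftUnitor_naturality_assoc]
  have hbot : (I.coid ≫ I.bot) ≫ I.comul =
      I.comul ≫ (I.coid ≫ I.bot ⊗ₘ I.coid ≫ I.bot) := by
    rw [Category.assoc, bot_comul, ← tensorHom_comp_tensorHom, ← Category.assoc I.comul,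
      comul_coid_tensor, Category.assoc]
  have hid : 𝟙 X ≫ I.comul = I.comul ≫ (𝟙 X ⊗ₘ 𝟙 X) := by simp
  apply hI.ext
  · exact aux _ _ I.bot_comul hm.bot_right hbot
  · exact aux _ (𝟙 _) I.top_comul (by rw [hm.top_right, Category.comp_id]) hid
  · exact aux' _ _ I.bot_comul hm.bot_left hbot
  · exact aux' _ (𝟙 _) I.top_comul (by rw [hm.top_left, Category.comp_id]) hid

/-- The commutative Hopf object given by a meet operation. -/
def hopf [HasPushouts C] (hI : I.IsSquareSeparated) (hm : I.IsMeet m) : CommHopf X where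
  bimon :=
    { one := I.top
      mul := m
      one_mul := hm.top_left
      mul_one := hm.top_right
      mul_assoc := hm.assoc hI
      counit := I.coid
      comul := I.comul
      counit_comul := I.comul_coid_whiskerRight
      comul_counit := I.comul_coid_whiskerLeft
      comul_assoc := I.comul_coassoc
      mul_comul := hm.mul_comul hI
      one_comul := I.top_comul
      mul_counit := hm.mul_coid hI
      one_counit := I.top_coid }
  comm :=
    letI : MonObj X :=
      { one := I.top
        mul := m
        one_mul := hm.top_left
        mul_one := hm.top_right
        mul_assoc := hm.assoc hI }
    { mul_comm := hm.comm hI }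

end IsMeet

end Meet

end Cocategory

/-! ### Uniqueness of the Hopf structure, and Hopf morphisms in terms of structure maps -/

section

variable {C : Type u} [Category.{v} C] [MonoidalCategory C]

theorem CommHopf.ext_of_maps [BraidedCategory C] {Y : C} {S T : CommHopf Y} (h₁ : S.mul = T.mul)
    (h₂ : S.one = T.one) (h₃ : S.comul = T.comul) (h₄ : S.counit = T.counit) : S = T := by
  obtain ⟨@⟨⟨_, _, _, _, _⟩, ⟨_, _, _, _, _⟩, _, _, _, _⟩, _⟩ := S
  obtain ⟨@⟨⟨_, _, _, _, _⟩, ⟨_, _, _, _, _⟩, _, _, _, _⟩, _⟩ := T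
  cases h₁
  cases h₂
  cases h₃
  cases h₄
  rfl

theorem Cocategory.existsUnique_isMeetHopf [SymmetricCategory C] [HasPushouts C] {X : C}
    {I : Interval X} (hI : I.IsSquareSeparated) (h : ∃ m, I.IsMeet m) :
    ∃! S : CommHopf X, I.IsMeetHopf S := by
  obtain ⟨m, hm⟩ := h
  refine ⟨hm.hopf hI, ⟨rfl, rfl, hm, rfl⟩, fun S hS => ?_⟩
  exact CommHopf.ext_of_maps (hS.mul.unique hI hm) hS.one hS.comul hS.counit

theorem CommHopf.isHom_iff [BraidedCategory C] {Y Z : C} {S : CommHopf Y} {T : CommHopf Z}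
    {f : Y ⟶ Z} : S.IsHom T f ↔ (S.one ≫ f = T.one ∧ S.mul ≫ f = (f ⊗ₘ f) ≫ T.mul) ∧
      f ≫ T.counit = S.counit ∧ f ≫ T.comul = S.comul ≫ (f ⊗ₘ f) := by
  let := S.bimon
  let := T.bimon
  constructor
  · intro h
    have h' : IsBimonHom f := h
    exact ⟨⟨h'.one_hom, h'.mul_hom⟩, h'.hom_counit, h'.hom_comul⟩
  · rintro ⟨⟨h1, h2⟩, h3, h4⟩
    have h' : IsBimonHom f := { one_hom := h1, mul_hom := h2, hom_counit := h3, hom_comul := h4 }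
    exact h'

end

end StrictInterval

end

noncomputable section

namespace StrictInterval

namespace Cocategory

/-! ### Interchanging the two cylinder variables -/

section Swap

variable {C : Type u} [Category.{v} C] [MonoidalCategory C] [SymmetricCategory C] {X : C}
  {I : Interval X}

/-- The interchange of the last two factors. -/
def swapRight (A B D : C) : (A ⊗ B) ⊗ D ⟶ (A ⊗ D) ⊗ B :=
  (α_ A B D).hom ≫ A ◁ (β_ B D).hom ≫ (α_ A D B).inv

theorem swapRight_swapRight (A B D : C) : swapRight A B D ≫ swapRight A D B = 𝟙 _ := by
  simp only [swapRight, Category.assoc, Iso.inv_hom_id_assoc]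
  rw [← whiskerLeft_comp_assoc, SymmetricCategory.symmetry]
  simp

instance (A B D : C) : IsIso (swapRight A B D) :=
  ⟨swapRight A D B, swapRight_swapRight _ _ _, swapRight_swapRight _ _ _⟩

theorem swapRight_naturality_left (A D : C) {B B' : C} (f : B ⟶ B') :
    (A ◁ f) ▷ D ≫ swapRight A B' D = swapRight A B D ≫ (A ⊗ D) ◁ f := by
  simp only [swapRight, Category.assoc]
  rw [associator_naturality_middle_assoc, ← whiskerLeft_comp_assoc,
    BraidedCategory.braiding_naturality_left, whiskerLeft_comp_assoc,
    associator_inv_naturality_right]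

theorem swapRight_unit (A B : C) : (ρ_ A).inv ▷ B ≫ swapRight A (𝟙_ C) B = (ρ_ _).inv := by
  simp [swapRight]

theorem botFace_whiskerRight_swapRight (A B : C) :
    I.botFace A ▷ B ≫ swapRight A X B = I.botFace (A ⊗ B) := by
  rw [botFace, botFace, comp_whiskerRight, Category.assoc, swapRight_naturality_left,
    ← Category.assoc, swapRight_unit]

theorem topFace_whiskerRight_swapRight (A B : C) :
    I.topFace A ▷ B ≫ swapRight A X B = I.topFace (A ⊗ B) := by
  rw [topFace, topFace, comp_whiskerRight, Category.assoc, swapRight_naturality_left,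
    ← Category.assoc, swapRight_unit]

end Swap

/-! ### Existence of the meet on `I` -/

section MeetExistence

variable {C : Type u} [Category.{v} C] [MonoidalCategory C] {X : C} {I : Interval X}

theorem botFace_unit (I : Interval X) : I.botFace (𝟙_ C) ≫ (λ_ X).hom = I.bot := by
  simp [botFace, ← unitors_inv_equal]

theorem topFace_unit (I : Interval X) : I.topFace (𝟙_ C) ≫ (λ_ X).hom = I.top := by
  simp [topFace, ← unitors_inv_equal]

theorem Representable.exists_isMeet [MonoidalClosed C] (hI : I.Representable) :
    ∃ m, I.IsMeet m := by
  let φ : I.TwoCell I.bot I.bot := I.path (I.coid ≫ I.bot) (by rw [reassoc_of% I.bot_coid])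
    (by rw [reassoc_of% I.top_coid])
  let ψ : I.TwoCell I.bot I.top := I.path (𝟙 X) (Category.comp_id _) (Category.comp_id _)
  -- In both directions the meet runs from the constant path `φ` at `⊥` to the identity path `ψ`, so
  -- both ways round the square are the same composite.
  obtain ⟨m, h₁, h₂, h₃, h₄⟩ := hI.square_exists φ ψ φ ψ rfl
  have hb : I.bot ≫ (λ_ X).inv = I.botFace (𝟙_ C) := by
    rw [← I.botFace_unit, Category.assoc, Iso.hom_inv_id, Category.comp_id]
  have ht : I.top ≫ (λ_ X).inv = I.topFace (𝟙_ C) := by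
    rw [← I.topFace_unit, Category.assoc, Iso.hom_inv_id, Category.comp_id]
  refine ⟨(λ_ X).inv ▷ X ≫ m, ?_, ?_, ?_, ?_⟩
  · rw [whisker_exchange_assoc, whiskerLeft_bot_eq, h₁, path_hom, rightUnitor_naturality_assoc,
      Iso.inv_hom_id_assoc]
  · rw [whisker_exchange_assoc, whiskerLeft_top_eq, h₂, path_hom, rightUnitor_naturality_assoc,
      Iso.inv_hom_id_assoc, Category.comp_id]
  · rw [← comp_whiskerRight_assoc, hb, h₃, path_hom]
  · rw [← comp_whiskerRight_assoc, ht, h₄, path_hom, Category.comp_id]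

end MeetExistence

/-! ### Invertibility as extension along `ι` -/

section FactorsFree

variable {C : Type u} [Category.{v} C] [MonoidalCategory C] [HasFiniteColimits C] {X : C}
  {I : Interval X}

variable (I) in
/-- The map `t` extends along the inclusion of `I` in the free invertible interval. -/
def FactorsFree {A Z : C} (t : A ⊗ X ⟶ Z) : Prop :=
  ∃ e : A ⊗ I.freeObj ⟶ Z, A ◁ I.freeIncl ≫ e = t

theorem FactorsFree.whiskerRight_comp {A B Z : C} {t : A ⊗ X ⟶ Z} (ht : I.FactorsFree t)
    (f : B ⟶ A) : I.FactorsFree (f ▷ X ≫ t) := by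
  obtain ⟨e, rfl⟩ := ht
  exact ⟨f ▷ _ ≫ e, by rw [whisker_exchange_assoc]⟩

theorem factorsFree_whiskerRight_iff {A B Z : C} {t : A ⊗ X ⟶ Z} (f : B ⟶ A) [IsIso f] :
    I.FactorsFree (f ▷ X ≫ t) ↔ I.FactorsFree t :=
  ⟨fun h => by simpa using h.whiskerRight_comp (inv f), fun h => h.whiskerRight_comp f⟩

variable [MonoidalClosed C]

theorem TwoCell.isInvertible_iff_factorsFree {A Z : C} {f g : A ⟶ Z} (η : I.TwoCell f g) :
    η.IsInvertible ↔ I.FactorsFree η.hom :=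
  ⟨fun h => h.exists_free, fun ⟨e, he⟩ => TwoCell.isInvertible_of_free e η he⟩

theorem Representable.factorsFree_of_faces (hI : I.Representable) {A Z : C}
    {m : (A ⊗ X) ⊗ X ⟶ Z} (hb : I.FactorsFree (I.botFace A ▷ X ≫ m))
    (ht : I.FactorsFree (I.topFace A ▷ X ≫ m)) : I.FactorsFree m := by
  let γ := TwoCell.mk' I m rfl rfl
  exact (TwoCell.isInvertible_iff_factorsFree γ).1 (hI.isInvertible_of_faces γ
    ((TwoCell.isInvertible_iff_factorsFree _).2 hb) ((TwoCell.isInvertible_iff_factorsFree _).2 ht))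

end FactorsFree

/-! ### Extending squares, and the meet, from `I` to `J` -/

section FreeSquares

variable {C : Type u} [Category.{v} C] [MonoidalCategory C] [SymmetricCategory C]
  [MonoidalClosed C] [HasFiniteColimits C] {X : C} {I : Interval X}

instance (A B : C) : Epi ((A ◁ I.freeIncl) ▷ B) := by
  have h : (A ◁ I.freeIncl) ▷ B =
      swapRight A X B ≫ (A ⊗ B) ◁ I.freeIncl ≫ swapRight A B I.freeObj := by
    rw [← reassoc_of% swapRight_naturality_left, swapRight_swapRight, Category.comp_id]
  rw [h]
  infer_instance

/-- Once a meet exists, this property is all that its uniqueness and the Hopf axioms require. It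
passes to `J` since `ι` is epi in each variable, so no representability of `J` is needed. -/
theorem IsSquareSeparated.free (hI : I.IsSquareSeparated) : I.free.IsSquareSeparated := by
  intro A Z m m' h₁ h₂ h₃ h₄
  have hb : I.bot ≫ I.freeIncl = I.free.bot := rfl
  have ht : I.top ≫ I.freeIncl = I.free.top := rfl
  rw [← cancel_epi ((A ⊗ I.freeObj) ◁ I.freeIncl), ← cancel_epi ((A ◁ I.freeIncl) ▷ X)]
  apply hI
  · rw [whisker_exchange_assoc, whisker_exchange_assoc, ← whiskerLeft_comp_assoc,
      ← whiskerLeft_comp_assoc, hb, h₁]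
  · rw [whisker_exchange_assoc, whisker_exchange_assoc, ← whiskerLeft_comp_assoc,
      ← whiskerLeft_comp_assoc, ht, h₂]
  · rw [← comp_whiskerRight_assoc, ← comp_whiskerRight_assoc, ← MonoidalCategory.whiskerLeft_comp,
      hb, ← whisker_exchange_assoc, ← whisker_exchange_assoc, h₃]
  · rw [← comp_whiskerRight_assoc, ← comp_whiskerRight_assoc, ← MonoidalCategory.whiskerLeft_comp,
      ht, ← whisker_exchange_assoc, ← whisker_exchange_assoc, h₄]

/-- Extension in the middle variable: after swapping, it becomes the last one, and the faces
criterion applies. -/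
theorem Representable.exists_whiskerRight_freeIncl (hI : I.Representable) {A Z : C}
    {m : (A ⊗ X) ⊗ X ⟶ Z} (hb : I.FactorsFree (I.botFace (A ⊗ X) ≫ m))
    (ht : I.FactorsFree (I.topFace (A ⊗ X) ≫ m)) :
    ∃ e : (A ⊗ I.freeObj) ⊗ X ⟶ Z, (A ◁ I.freeIncl) ▷ X ≫ e = m := by
  obtain ⟨e, he⟩ : I.FactorsFree (swapRight A X X ≫ m) := by
    apply hI.factorsFree_of_faces
    · rwa [← Category.assoc, botFace_whiskerRight_swapRight]
    · rwa [← Category.assoc, topFace_whiskerRight_swapRight]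
  refine ⟨swapRight _ _ _ ≫ e, ?_⟩
  rw [reassoc_of% swapRight_naturality_left, he, reassoc_of% swapRight_swapRight]

/-- The faces criterion with `J` as the inner cylinder. Restricted to `I`, the 2-cell has an inverse
by the earlier criterion; that inverse extends over `J`, and the inverse laws are tested along the
epimorphism `ι`. -/
theorem Representable.factorsFree_of_free_faces (hI : I.Representable) {A Z : C}
    {m : (A ⊗ I.freeObj) ⊗ X ⟶ Z} (hb : I.FactorsFree (I.free.botFace A ▷ X ≫ m))
    (ht : I.FactorsFree (I.free.topFace A ▷ X ≫ m)) : I.FactorsFree m := by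
  have hbf : I.botFace A ≫ A ◁ I.freeIncl = I.free.botFace A := by
    rw [botFace, Category.assoc, ← MonoidalCategory.whiskerLeft_comp]; rfl
  have htf : I.topFace A ≫ A ◁ I.freeIncl = I.free.topFace A := by
    rw [topFace, Category.assoc, ← MonoidalCategory.whiskerLeft_comp]; rfl
  let γ := TwoCell.mk' I m rfl rfl
  let γ' := TwoCell.whiskerLeft (A ◁ I.freeIncl) γ
  have hγ' : γ'.IsInvertible := by
    refine (TwoCell.isInvertible_iff_factorsFree γ').2 (hI.factorsFree_of_faces ?_ ?_)
    · rw [TwoCell.whiskerLeft_hom, ← comp_whiskerRight_assoc, hbf]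
      exact hb
    · rw [TwoCell.whiskerLeft_hom, ← comp_whiskerRight_assoc, htf]
      exact ht
  obtain ⟨n', h₁, h₂⟩ := (TwoCell.isInvertible_iff _).1 hγ'
  -- The source and target of `n'` are those of `γ'`, exchanged, and these are restrictions along `A
  -- ◁ ι` of maps out of `A ⊗ J`.
  obtain ⟨n₀, hn₀⟩ := hI.exists_whiskerRight_freeIncl (m := n'.hom)
    ⟨_, n'.botFace_hom.symm⟩ ⟨_, n'.topFace_hom.symm⟩
  let n := TwoCell.mk' I (f := I.topFace _ ≫ m) (g := I.botFace _ ≫ m) n₀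
    (by rw [← cancel_epi (A ◁ I.freeIncl), ← reassoc_of% botFace_naturality, hn₀, n'.botFace_hom])
    (by rw [← cancel_epi (A ◁ I.freeIncl), ← reassoc_of% topFace_naturality, hn₀, n'.topFace_hom])
  have hn : TwoCell.whiskerLeft (A ◁ I.freeIncl) n = n' := TwoCell.ext hn₀
  refine (TwoCell.isInvertible_iff_factorsFree γ).1
    ((TwoCell.isInvertible_iff _).2 ⟨n, TwoCell.ext ?_, TwoCell.ext ?_⟩)
  · rw [← cancel_epi ((A ◁ I.freeIncl) ▷ X)]
    change (TwoCell.whiskerLeft _ (γ.comp n)).hom = (TwoCell.whiskerLeft _ (TwoCell.id _)).hom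
    rw [TwoCell.comp_whiskerLeft, TwoCell.whiskerLeft_id, hn, h₁]
  · rw [← cancel_epi ((A ◁ I.freeIncl) ▷ X)]
    change (TwoCell.whiskerLeft _ (n.comp γ)).hom = (TwoCell.whiskerLeft _ (TwoCell.id _)).hom
    rw [TwoCell.comp_whiskerLeft, TwoCell.whiskerLeft_id, hn, h₂]

/-- The meet operation of `I` extends to one of the free invertible interval. -/
theorem Representable.exists_free_isMeet (hI : I.Representable) {m : X ⊗ X ⟶ X}
    (hm : I.IsMeet m) : ∃ m' : I.freeObj ⊗ I.freeObj ⟶ I.freeObj, I.free.IsMeet m' ∧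
      (I.freeIncl ⊗ₘ I.freeIncl) ≫ m' = m ≫ I.freeIncl := by
  have hb : I.bot ≫ I.freeIncl = I.free.bot := rfl
  have ht : I.top ≫ I.freeIncl = I.free.top := rfl
  have hi : I.freeIncl ≫ I.free.coid = I.coid := I.freeIncl_isIntervalHom.coid
  have hc := hm.comm hI.isSquareSeparated
  have cbot : I.FactorsFree ((λ_ X).hom ≫ I.coid ≫ I.bot ≫ I.freeIncl) :=
    ⟨(λ_ _).hom ≫ I.free.coid ≫ I.free.bot, by
      rw [leftUnitor_naturality_assoc, reassoc_of% hi, hb]⟩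
  have ctop : I.FactorsFree ((λ_ X).hom ≫ I.freeIncl) :=
    ⟨(λ_ _).hom, by rw [leftUnitor_naturality]⟩
  -- Extension in the second variable, with `X ⊗ X` regarded as `(𝟙_ C ⊗ X) ⊗ X`; the faces at the
  -- two ends of the first variable are `cbot` and `ctop`.
  obtain ⟨e, he⟩ : I.FactorsFree (m ≫ I.freeIncl) := by
    rw [← factorsFree_whiskerRight_iff (λ_ X).hom]
    apply hI.factorsFree_of_faces
    · rwa [← comp_whiskerRight_assoc, botFace_unit, reassoc_of% hm.bot_left]
    · rwa [← comp_whiskerRight_assoc, topFace_unit, reassoc_of% hm.top_left]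
  have he' : I.freeIncl ▷ X ≫ (β_ _ _).hom ≫ e = m ≫ I.freeIncl := by
    rw [BraidedCategory.braiding_naturality_left_assoc, he, reassoc_of% hc]
  -- The braiding brings the variable not yet extended to the last place. By commutativity of `m`
  -- the faces to be checked are `cbot` and `ctop` again.
  obtain ⟨m', hm'⟩ : I.FactorsFree ((β_ _ _).hom ≫ e) := by
    rw [← factorsFree_whiskerRight_iff (λ_ I.freeObj).hom]
    apply hI.factorsFree_of_free_faces
    · rwa [← comp_whiskerRight_assoc, botFace_unit, ← hb, comp_whiskerRight_assoc, he',
        reassoc_of% hm.bot_left]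
    · rwa [← comp_whiskerRight_assoc, topFace_unit, ← ht, comp_whiskerRight_assoc, he',
        reassoc_of% hm.top_left]
  have h : I.freeIncl ▷ X ≫ I.freeObj ◁ I.freeIncl ≫ m' = m ≫ I.freeIncl := by rw [hm', he']
  refine ⟨m', ⟨?_, ?_, ?_, ?_⟩, by rw [MonoidalCategory.tensorHom_def, Category.assoc, h]⟩
  · rw [← cancel_epi (I.freeIncl ▷ _), ← hb, MonoidalCategory.whiskerLeft_comp, Category.assoc,
      ← whisker_exchange_assoc, h, reassoc_of% hm.bot_right, rightUnitor_naturality_assoc,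
      reassoc_of% hi]
  · rw [← cancel_epi (I.freeIncl ▷ _), ← ht, MonoidalCategory.whiskerLeft_comp, Category.assoc,
      ← whisker_exchange_assoc, h, reassoc_of% hm.top_right, rightUnitor_naturality]
  · rw [← cancel_epi (_ ◁ I.freeIncl), ← hb, comp_whiskerRight, Category.assoc,
      whisker_exchange_assoc, whisker_exchange_assoc, h, reassoc_of% hm.bot_left,
      leftUnitor_naturality_assoc, reassoc_of% hi]
  · rw [← cancel_epi (_ ◁ I.freeIncl), ← ht, comp_whiskerRight, Category.assoc,
      whisker_exchange_assoc, whisker_exchange_assoc, h, reassoc_of% hm.top_left,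
      leftUnitor_naturality]

end FreeSquares

end Cocategory

end StrictInterval

end

noncomputable section

namespace StrictInterval

namespace Cocategory

/-! ### Weak equivalences -/

section WeakEquivalences

section

variable {C : Type u} [Category.{v} C] [MonoidalCategory C] {X : C} {I : Interval X}

/-- This compares composites whose boundary arrows agree only propositionally, such as `(h ≫ f) ≫ g`
and `h ≫ (f ≫ g)`, where the 2-cells themselves have different types. -/
theorem TwoCell.comp_hom_congr [MonoidalClosed C] {A B : C} {f g h f' g' h' : A ⟶ B} {η : I.TwoCell f g}
    {γ : I.TwoCell g h} {η' : I.TwoCell f' g'} {γ' : I.TwoCell g' h'} (e₁ : η.hom = η'.hom)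
    (e₂ : γ.hom = γ'.hom) : (η.comp γ).hom = (η'.comp γ').hom := by
  obtain rfl : f = f' := by rw [← η.botFace_hom, e₁, η'.botFace_hom]
  obtain rfl : g = g' := by rw [← η.topFace_hom, e₁, η'.topFace_hom]
  obtain rfl : h = h' := by rw [← γ.topFace_hom, e₂, γ'.topFace_hom]
  rw [TwoCell.ext e₁, TwoCell.ext e₂]

theorem bot_leftUnitor_inv_hom {Z : C} {a b : 𝟙_ C ⟶ Z} (η : I.TwoCell a b) :
    I.bot ≫ (λ_ X).inv ≫ η.hom = a := by
  rw [← I.botFace_unit, Category.assoc, Iso.hom_inv_id_assoc, η.botFace_hom]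

theorem top_leftUnitor_inv_hom {Z : C} {a b : 𝟙_ C ⟶ Z} (η : I.TwoCell a b) :
    I.top ≫ (λ_ X).inv ≫ η.hom = b := by
  rw [← I.topFace_unit, Category.assoc, Iso.hom_inv_id_assoc, η.topFace_hom]

end

variable {C : Type u} [Category.{v} C] [MonoidalCategory C] [MonoidalClosed C]
  [HasFiniteColimits C] {X : C} {I : Interval X}

/-- Invertibility is extension over `A ⊗ J`, a condition on the underlying map alone. -/
theorem TwoCell.IsInvertible.of_hom_eq {A B : C} {f g f' g' : A ⟶ B} {η : I.TwoCell f g}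
    {η' : I.TwoCell f' g'} (h : η.IsInvertible) (e : η.hom = η'.hom) : η'.IsInvertible := by
  rw [isInvertible_iff_factorsFree] at h ⊢
  rwa [← e]

/-- An invertible 2-cell `f ≫ g ⟹ 𝟙 A` induces an isomorphism of postcomposition functors. -/
def postcompIso (hI : I.Interchange) {A B : C} {f : A ⟶ B} {g : B ⟶ A}
    (α : I.TwoCell (f ≫ g) (𝟙 A)) (hα : α.IsInvertible) (E : C) :
    I.postcomp E f ⋙ I.postcomp E g ≅ 𝟭 (I.HomCat E A) :=
  let app (h : E ⟶ A) : I.TwoCell ((h ≫ f) ≫ g) h :=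
    TwoCell.mk' I (TwoCell.whiskerLeft h α).hom
      (by rw [TwoCell.botFace_hom, Category.assoc]) (by rw [TwoCell.topFace_hom, Category.comp_id])
  have happ (h : E ⟶ A) : (app h).IsInvertible := (hα.whiskerLeft h).of_hom_eq rfl
  have nat {h k : E ⟶ A} (η : I.TwoCell h k) :
      ((η.whiskerRight f).whiskerRight g).comp (app k) = (app h).comp η := by
    ext
    have h₁ : (((η.whiskerRight f).whiskerRight g).comp (app k)).hom =
        ((η.whiskerRight (f ≫ g)).comp (TwoCell.whiskerLeft k α)).hom :=
      TwoCell.comp_hom_congr (Category.assoc _ _ _) rfl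
    have h₂ : ((TwoCell.whiskerLeft h α).comp (η.whiskerRight (𝟙 A))).hom =
        ((app h).comp η).hom :=
      TwoCell.comp_hom_congr rfl (Category.comp_id _)
    rw [h₁, ← hI η α, h₂]
  NatIso.ofComponents (fun h => @asIso (I.HomCat E A) _ _ _ (app h) (happ h)) (fun η => nat η)

/-- Postcomposition with a weak equivalence is fully faithful. -/
def fullyFaithfulPostcomp (hI : I.Interchange) {A B : C} {f : A ⟶ B}
    (hf : I.weakEquivalences f) (E : C) : (I.postcomp E f).FullyFaithful :=
  let g := hf.choose
  let a : @Iso (I.HomCat A A) _ (f ≫ g) (𝟙 A) := hf.choose_spec.1.some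
  let b : @Iso (I.HomCat B B) _ (g ≫ f) (𝟙 B) := hf.choose_spec.2.some
  (CategoryTheory.Equivalence.mk (I.postcomp E f) (I.postcomp E g)
    (postcompIso hI a.hom (a.isIso_hom) E).symm
    (postcompIso hI b.hom (b.isIso_hom) E)).fullyFaithfulFunctor

theorem TwoCell.IsInvertible.of_weakEquivalence (hI : I.Interchange) {A B E : C} {p : A ⟶ B}
    (hp : I.weakEquivalences p) {f g : E ⟶ A} {η : I.TwoCell f g}
    (h : (η.whiskerRight p).IsInvertible) : η.IsInvertible :=
  @Functor.FullyFaithful.isIso_of_isIso_map _ _ _ _ _ (fullyFaithfulPostcomp hI hp E) f g η h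

theorem exists_whiskerRight_eq (hI : I.Interchange) {A B E : C} {p : A ⟶ B}
    (hp : I.weakEquivalences p) {f g : E ⟶ A} (γ : I.TwoCell (f ≫ p) (g ≫ p)) :
    ∃ η : I.TwoCell f g, η.whiskerRight p = γ :=
  (fullyFaithfulPostcomp hI hp E).map_surjective (X := f) (Y := g) γ

theorem TwoCell.IsInvertible.exists_free_point {Z : C} {a b : 𝟙_ C ⟶ Z} {η : I.TwoCell a b}
    (h : η.IsInvertible) : ∃ e : I.freeObj ⟶ Z, I.freeIncl ≫ e = (λ_ X).inv ≫ η.hom := by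
  obtain ⟨e, he⟩ := h.exists_free
  exact ⟨(λ_ _).inv ≫ e, by rw [leftUnitor_inv_naturality_assoc, he]⟩

/-- A lifting problem is an invertible path in `B` between the images of two points of `A`. Full
faithfulness of postcomposition with the weak equivalence `p` lifts it strictly to an invertible
path between these points, which then extends over `J`. -/
theorem Interchange.cofibrations_free (hI : I.Interchange) :
    I.cofibrations (coprod.desc I.free.bot I.free.top) := by
  rintro A B p ⟨-, hp⟩
  refine ⟨fun {u v} sq => ?_⟩
  have w₁ : I.bot ≫ I.freeIncl ≫ v = (coprod.inl ≫ u) ≫ p := by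
    rw [Category.assoc, sq.w, coprod.inl_desc_assoc]
    exact (Category.assoc _ _ _).symm
  have w₂ : I.top ≫ I.freeIncl ≫ v = (coprod.inr ≫ u) ≫ p := by
    rw [Category.assoc, sq.w, coprod.inr_desc_assoc]
    exact (Category.assoc _ _ _).symm
  obtain ⟨η, hη⟩ := exists_whiskerRight_eq hI hp (I.path (I.freeIncl ≫ v) w₁ w₂)
  have hinv : η.IsInvertible := by
    apply TwoCell.IsInvertible.of_weakEquivalence hI hp
    rw [hη]
    exact path_isInvertible v w₁ w₂
  obtain ⟨e, he⟩ := hinv.exists_free_point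
  refine ⟨⟨⟨e, ?_, ?_⟩⟩⟩
  · apply coprod.hom_ext
    · rw [coprod.inl_desc_assoc]
      change (I.bot ≫ I.freeIncl) ≫ e = _
      rw [Category.assoc, he, bot_leftUnitor_inv_hom]
    · rw [coprod.inr_desc_assoc]
      change (I.top ≫ I.freeIncl) ≫ e = _
      rw [Category.assoc, he, top_leftUnitor_inv_hom]
  · rw [← cancel_epi I.freeIncl, reassoc_of% he]
    have := congrArg TwoCell.hom hη
    rw [TwoCell.whiskerRight_hom, path_hom] at this
    rw [this, Iso.inv_hom_id_assoc]

/-- The meet contracts `J` to `⊥`; the contraction is an invertible 2-cell because it is defined on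
all of `J ⊗ J`. -/
theorem IsMeet.weakEquivalences_free {m : I.freeObj ⊗ I.freeObj ⟶ I.freeObj}
    (hm : I.free.IsMeet m) : I.weakEquivalences I.free.coid := by
  refine ⟨I.free.bot, ⟨?_⟩, ⟨@eqToIso (I.HomCat _ _) _ _ _ I.free.bot_coid⟩⟩
  let η : I.TwoCell (I.free.coid ≫ I.free.bot) (𝟙 I.freeObj) :=
    { hom := I.freeObj ◁ I.freeIncl ≫ m
      bot_hom := by
        rw [← whiskerLeft_comp_assoc]
        exact hm.bot_right
      top_hom := by
        rw [← whiskerLeft_comp_assoc, Category.comp_id]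
        exact hm.top_right }
  exact @asIso (I.HomCat _ _) _ _ _ η (TwoCell.isInvertible_of_free m η rfl)

end WeakEquivalences

/-! ### Hopf intervals -/

section HopfIntervals

variable {C : Type u} [Category.{v} C] [MonoidalCategory C] [SymmetricCategory C]

namespace IsMeetHopf

variable {X : C} {I : Interval X} {S : CommHopf X}

theorem isHom_unit (hS : I.IsMeetHopf S) (hI : I.IsSquareSeparated) :
    S.IsHom (CommHopf.unit C) I.coid := by
  refine CommHopf.isHom_iff.2 ⟨⟨?_, ?_⟩, ?_, ?_⟩
  · rw [hS.one, I.top_coid]; rfl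
  · exact hS.mul.mul_coid hI
  · rw [hS.counit]; exact Category.comp_id _
  · rw [hS.comul]; exact I.comul_coid_tensor.symm

theorem isHom_twoPoints [HasBinaryCoproducts C] [MonoidalClosed C] (hS : I.IsMeetHopf S) :
    (CommHopf.twoPoints C).IsHom S (coprod.desc I.bot I.top) := by
  have hb : CommHopf.botPt C ≫ coprod.desc I.bot I.top = I.bot := coprod.inl_desc _ _
  have ht : CommHopf.topPt C ≫ coprod.desc I.bot I.top = I.top := coprod.inr_desc _ _
  have hf : coprod.desc I.bot I.top ≫ I.coid = CommHopf.fold C := by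
    rw [coprod.desc_comp, I.bot_coid, I.top_coid]
    rfl
  refine CommHopf.isHom_iff.2 ⟨⟨?_, ?_⟩, ?_, ?_⟩
  · rw [hS.one]; exact ht
  · apply CommHopf.whiskerLeft_twoPt_ext
    · refine (CommHopf.bot_meet_assoc _ _).trans ?_
      rw [hb, MonoidalCategory.tensorHom_def, Category.assoc, whisker_exchange_assoc,
        ← whiskerLeft_comp_assoc, hb, hS.mul.bot_right, rightUnitor_naturality_assoc,
        reassoc_of% hf]
    · refine (CommHopf.top_meet_assoc _ _).trans ?_
      rw [MonoidalCategory.tensorHom_def, Category.assoc, whisker_exchange_assoc,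
        ← whiskerLeft_comp_assoc, ht, hS.mul.top_right, rightUnitor_naturality]
  · rw [hS.counit]; exact hf
  · rw [hS.comul]
    apply CommHopf.twoPt_ext
    · refine Eq.trans ?_ (CommHopf.bot_comul_assoc _ _).symm
      rw [reassoc_of% hb, bot_comul, tensorHom_comp_tensorHom, hb]
    · refine Eq.trans ?_ (CommHopf.top_comul_assoc _ _).symm
      rw [reassoc_of% ht, top_comul, tensorHom_comp_tensorHom, ht]

end IsMeetHopf

variable [MonoidalClosed C] [HasFiniteColimits C] {X : C} {I : Interval X}

instance : Epi (I.freeIncl ⊗ₘ I.freeIncl) := by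
  rw [MonoidalCategory.tensorHom_def]
  infer_instance

variable {SI : CommHopf X} {SJ : CommHopf I.freeObj}

theorem Representable.freeIncl_isHom (hI : I.Representable) (hSI : I.IsMeetHopf SI)
    (hSJ : I.free.IsMeetHopf SJ) : SI.IsHom SJ I.freeIncl := by
  obtain ⟨m, hm, h⟩ := hI.exists_free_isMeet hSI.mul
  refine CommHopf.isHom_iff.2 ⟨⟨?_, ?_⟩, ?_, ?_⟩
  · rw [hSI.one, hSJ.one]; rfl
  · rw [← h, hSJ.mul.unique hI.isSquareSeparated.free hm]
  · rw [hSI.counit, hSJ.counit, I.freeIncl_isIntervalHom.coid]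
  · rw [hSI.comul, hSJ.comul, I.freeIncl_isIntervalHom.comul]

theorem Representable.isHopfInterval_free (hI : I.Representable) (hSJ : I.free.IsMeetHopf SJ) :
    I.IsHopfInterval SJ (coprod.desc I.free.bot I.free.top) I.free.coid where
  fac := by rw [coprod.desc_comp, I.free.bot_coid, I.free.top_coid]
  cofibration := hI.interchange.cofibrations_free
  weakEquivalence := hSJ.mul.weakEquivalences_free
  incl_hom := hSJ.isHom_twoPoints
  proj_hom := hSJ.isHom_unit hI.isSquareSeparated.free

theorem isHom_of_freeIncl_comp {Y : C} {S : CommHopf Y} {ξ : X ⟶ Y} {ξ' : I.freeObj ⟶ Y}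
    (hι : SI.IsHom SJ I.freeIncl) (hξ : SI.IsHom S ξ) (h : I.freeIncl ≫ ξ' = ξ) :
    SJ.IsHom S ξ' := by
  obtain ⟨⟨a₁, a₂⟩, a₃, a₄⟩ := CommHopf.isHom_iff.1 hι
  obtain ⟨⟨b₁, b₂⟩, b₃, b₄⟩ := CommHopf.isHom_iff.1 hξ
  refine CommHopf.isHom_iff.2 ⟨⟨?_, ?_⟩, ?_, ?_⟩
  · rw [← a₁, Category.assoc, h, b₁]
  · rw [← cancel_epi (I.freeIncl ⊗ₘ I.freeIncl), ← reassoc_of% a₂, h, b₂,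
      tensorHom_comp_tensorHom_assoc, h]
  · rw [← cancel_epi I.freeIncl, reassoc_of% h, b₃, a₃]
  · rw [← cancel_epi I.freeIncl, reassoc_of% h, b₄, reassoc_of% a₄, tensorHom_comp_tensorHom, h]

/-- The counit of the trivial structure on the unit is the identity, so preservation of counits
leaves no choice. -/
theorem IsHopfInterval.proj_eq_counit {Y : C} {S : CommHopf Y} {incl : 𝟙_ C ⨿ 𝟙_ C ⟶ Y}
    {proj : Y ⟶ 𝟙_ C} (h : I.IsHopfInterval S incl proj) : proj = S.counit :=
  (Category.comp_id proj).symm.trans (CommHopf.isHom_iff.1 h.proj_hom).2.1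

/-- The weak equivalence `proj` reflects invertibility, and it takes the path `ξ` to `coid`, which
extends over `J`. -/
theorem IsHopfInterval.exists_free (hI : I.Interchange) {Y : C} {S : CommHopf Y}
    {incl : 𝟙_ C ⨿ 𝟙_ C ⟶ Y} {proj : Y ⟶ 𝟙_ C} (h : I.IsHopfInterval S incl proj) {ξ : X ⟶ Y}
    (hξ : ξ ≫ proj = I.coid) : ∃ ξ' : I.freeObj ⟶ Y, I.freeIncl ≫ ξ' = ξ := by
  have hinv : (I.path ξ rfl rfl).IsInvertible := by
    apply TwoCell.IsInvertible.of_weakEquivalence hI h.weakEquivalence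
    rw [TwoCell.isInvertible_iff_factorsFree]
    refine ⟨(λ_ _).hom ≫ I.free.coid, ?_⟩
    rw [leftUnitor_naturality_assoc, I.freeIncl_isIntervalHom.coid, TwoCell.whiskerRight_hom,
      path_hom, Category.assoc, hξ]
  exact exists_free_of_path hinv

end HopfIntervals

end Cocategory

end StrictInterval

end

/-! ### The proposition -/

theorem mainTheorem5 {C : Type u} [Category.{v} C] [MonoidalCategory C] [SymmetricCategory C]
    [MonoidalClosed C] [HasFiniteLimits C] [HasFiniteColimits C] {X : C}
    (I : StrictInterval.Interval X) (hI : I.Representable) :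
    ∃ J : StrictInterval.Interval I.freeObj,
      -- `J` is an invertible interval, with the structure induced from the pushout
      I.IsQuotientStructure J ∧
      (∃ s : I.freeObj ⟶ I.freeObj, J.IsSymmetry s ∧ I.freeQuot ≫ s = I.kSymm ≫ I.freeQuot) ∧
      -- `J` is the free invertible interval generated by `I`
      StrictInterval.IsIntervalHom I J I.freeIncl ∧
      (∀ {Y : C} (H : StrictInterval.Interval Y), H.Invertible →
        ∀ ξ : X ⟶ Y, StrictInterval.IsIntervalHom I H ξ →
          ∃! ξ' : I.freeObj ⟶ Y, StrictInterval.IsIntervalHom J H ξ' ∧ I.freeIncl ≫ ξ' = ξ) ∧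
      -- the meet structures make `I` and `J` commutative Hopf objects
      (∃! S : StrictInterval.CommHopf X, I.IsMeetHopf S) ∧
      (∃! S : StrictInterval.CommHopf I.freeObj, J.IsMeetHopf S) ∧
      ∀ (SI : StrictInterval.CommHopf X) (SJ : StrictInterval.CommHopf I.freeObj),
        I.IsMeetHopf SI → J.IsMeetHopf SJ →
        -- `J` is a commutative Hopf interval
        I.IsHopfInterval SJ (coprod.desc J.bot J.top) J.coid ∧
        -- and it is the free one generated by `I`
        SI.IsHom SJ I.freeIncl ∧
        ∀ {Y : C} (S : StrictInterval.CommHopf Y) (incl : 𝟙_ C ⨿ 𝟙_ C ⟶ Y) (proj : Y ⟶ 𝟙_ C),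
          I.IsHopfInterval S incl proj →
          ∀ ξ : X ⟶ Y, SI.IsHom S ξ →
            ∃ ξ' : I.freeObj ⟶ Y,
              SJ.IsHom S ξ' ∧ I.freeIncl ≫ ξ' = ξ ∧ ξ' ≫ proj = J.coid ∧
              (coprod.desc I.bot I.top ≫ ξ = incl → coprod.desc J.bot J.top ≫ ξ' = incl) ∧
              ∀ χ : I.freeObj ⟶ Y, SJ.IsHom S χ → I.freeIncl ≫ χ = ξ → χ = ξ' := by
  obtain ⟨m, hm⟩ := hI.exists_isMeet
  obtain ⟨m', hm', -⟩ := hI.exists_free_isMeet hm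
  refine ⟨I.free, I.free_isQuotientStructure, ⟨I.freeSymm, I.free_isSymmetry, I.freeQuot_freeSymm⟩,
    I.freeIncl_isIntervalHom, I.free_universal,
    StrictInterval.Cocategory.existsUnique_isMeetHopf hI.isSquareSeparated ⟨m, hm⟩,
    StrictInterval.Cocategory.existsUnique_isMeetHopf hI.isSquareSeparated.free ⟨m', hm'⟩, ?_⟩
  intro SI SJ hSI hSJ
  have hι := hI.freeIncl_isHom hSI hSJ
  refine ⟨hI.isHopfInterval_free hSJ, hι, ?_⟩
  intro Y S incl proj hH ξ hξ
  -- Preservation of the counit is the only part of the Hopf morphism condition that the existence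
  -- of the extension uses.
  have hproj : ξ ≫ proj = I.coid := by
    rw [hH.proj_eq_counit, (StrictInterval.CommHopf.isHom_iff.1 hξ).2.1, hSI.counit]
  obtain ⟨ξ', hξ'⟩ := hH.exists_free hI.interchange hproj
  refine ⟨ξ', StrictInterval.Cocategory.isHom_of_freeIncl_comp hι hξ hξ', hξ', ?_, ?_, ?_⟩
  · rw [← cancel_epi I.freeIncl, reassoc_of% hξ', hproj, I.freeIncl_isIntervalHom.coid]
  · rintro rfl
    rw [coprod.desc_comp, coprod.desc_comp, ← hξ', ← Category.assoc, ← Category.assoc,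
      I.freeIncl_isIntervalHom.bot, I.freeIncl_isIntervalHom.top]
  · intro χ _ hχ
    rw [← cancel_epi I.freeIncl, hχ, hξ']
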